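/- Let $\Psi:[0,\infty)\to[0,\infty)$ be a finite Young function, i.e. a continuous, nondecreasing, convex function with $\Psi(0)=0$ and $\lim_{x\to\infty}\Psi(x)=\infty$. Let $(\Omega,\mathcal F,\mathbb P)$ be an atomless probability space, and let $H^\Psi$ be the Orlicz heart, i.e. the space of all (a.s. equivalence classes of) real random variables $X$ on $\Omega$ with $\mathbb E[\Psi(c|X|)]<\infty$ for all $c>0$. Let $\mathcal M(H^\Psi)$ be the set of the distributions $\mathbb P\circ X^{-1}$, $X\in H^\Psi$. A law-invariant convex risk measure on $H^\Psi$ is a map $\rho:H^\Psi\to\mathbb R$ such that for all $X,Y\in H^\Psi$: $\rho(X)\ge\rho(Y)$ if $X\le Y$ a.s.; $\rho(\lambda X+(1-\lambda)Y)\le\lambda\rho(X)+(1-\lambda)\rho(Y)$ for $\lambda\in[0,1]$; and $\rho(X)=\rho(Y)$ if $X$ and $Y$ have the same distribution. Its risk functional $\mathcal R_\rho:\mathcal M(H^\Psi)\to\mathbb R$ is defined by $\mathcal R_\rho(\mathbb P\circ X^{-1})=\rho(X)$. Let $\rho$ be any law-invariant convex risk measure on $H^\Psi$. Let $A_d:\mathbb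 R^d\to\mathbb R$ be a Borel measurable map of linear growth: there are constants $b,c>0$ with $|A_d(x)|\le b+c\sum_{i=1}^d|x_i|$ for all $x\in\mathbb R^d$. Let $\mu_1,\dots,\mu_d\in\mathcal M(H^\Psi)$, and let $$M:=M(\mu_1,\dots,\mu_d;A_d):=\{\boldsymbol\mu\circ A_d^{-1}:\ \boldsymbol\mu \text{ is a Borel probability measure on } \mathbb R^d \text{ with one-dimensional marginals } \mu_1,\dots,\mu_d\}.$$ Then $M\subseteq\mathcal M(H^\Psi)$, and the restriction of $\mathcal R_\rho$ to $M$ is continuous for the relative weak topology on $M$ (aggregation robustness). Moreover, all empirical probability measures $\widehat m_n(x)=\frac1n\sum_{i=1}^n\delta_{x_i}$ with $n\ge1$ and $x=(x_1,x_2,\dots)\in\mathbb R^{\mathbb N}$ belong to $\mathcal M(H^\Psi)$, the plug-in estimators $\widehat T_n:\mathbb R^{\mathbb N}\to\mathbb R$, $\widehat T_n(x):=\mathcal R_\rho(\widehat m_n(x))$, are measurable, and the sequence $(\widehat T_n)_{n\ge1}$ is robust on $M$: for every $\mu\in M$ and $\varepsilon>0$ there is a neighbourhood $U$ of $\mu$,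 open in the relative weak topology on $M$, such that $$\pi\big(\mu^{\otimes\mathbb N}\circ\widehat T_n^{-1},\ \nu^{\otimes\mathbb N}\circ\widehat T_n^{-1}\big)\le\varepsilon\qquad\text{for all }\nu\in U\text{ and all }n\ge1,$$ where $\pi$ denotes the Prohorov metric on the Borel probability measures on $\mathbb R$. -/

import Mathlib

open MeasureTheory Filter Topology
open scoped NNReal ENNReal

noncomputable section

namespace AggRobust

/-! ### Statistical model, plug-in estimators, qualitative robustness -/

section Robust

variable {E S : Type*} [MeasurableSpace E]

/-- The empirical probability measure `(1/n) ∑_{i<n} δ_{x i}` of the first `n ≥ 1` entries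
of the sequence `x` (entries are indexed from `0`). -/
def empiricalMeasure (n : ℕ+) (x : ℕ → E) : ProbabilityMeasure E :=
  ⟨((n : ℕ) : ℝ≥0∞)⁻¹ • ∑ i ∈ Finset.range n, Measure.dirac (x i), ⟨by
    simp only [Measure.smul_apply, Measure.finsetSum_apply, measure_univ, Finset.sum_const,
      Finset.card_range, smul_eq_mul, nsmul_eq_mul, mul_one]
    exact ENNReal.inv_mul_cancel (by simp) (ENNReal.natCast_ne_top _)⟩⟩

variable (E) in
/-- The set of all empirical probability measures on `E`. -/
def empiricalMeasures : Set (ProbabilityMeasure E) :=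
  {m | ∃ (n : ℕ+) (x : ℕ → E), m = empiricalMeasure n x}

/-- The plug-in estimator `x ↦ T (m̂ₙ(x))` of a statistical functional `T` whose domain `D`
contains all empirical probability measures. -/
def plugIn {D : Set (ProbabilityMeasure E)} (hD : empiricalMeasures E ⊆ D) (T : D → S)
    (n : ℕ+) (x : ℕ → E) : S :=
  T ⟨empiricalMeasure n x, hD ⟨n, x, rfl⟩⟩

/-- The law, under the infinite product measure `μ^{⊗ℕ}`, of an estimator `t : E^ℕ → S`. -/
def estimatorLaw [MeasurableSpace S] (μ : ProbabilityMeasure E) (t : (ℕ → E) → S) : Measure S :=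
  (Measure.infinitePi fun _ : ℕ => (μ : Measure E)).map t

variable [TopologicalSpace E] [OpensMeasurableSpace E]
  [MeasurableSpace S] [PseudoMetricSpace S]

/-- `M`-robustness at `μ` of a sequence of estimators `t n`, `n ≥ 1`: the neighbourhood `U` is
open in the relative weak topology of `M`, and does not depend on `n`. -/
def IsRobustAt (t : ℕ+ → (ℕ → E) → S) (M : Set (ProbabilityMeasure E)) (μ : M) : Prop :=
  ∀ ε : ℝ, 0 < ε → ∃ U : Set M, IsOpen U ∧ μ ∈ U ∧ ∀ ν ∈ U, ∀ n : ℕ+,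
    levyProkhorovDist (estimatorLaw (μ : ProbabilityMeasure E) (t n))
      (estimatorLaw (ν : ProbabilityMeasure E) (t n)) ≤ ε

/-- Robustness of a sequence of estimators on `M`. -/
def IsRobustOn (t : ℕ+ → (ℕ → E) → S) (M : Set (ProbabilityMeasure E)) : Prop :=
  ∀ μ : M, IsRobustAt t M μ

end Robust

/-! ### Orlicz hearts and law-invariant convex risk measures -/

/-- A finite Young function `Ψ : [0,∞) → [0,∞)`. -/
structure YoungFunction where
  toFun : ℝ≥0 → ℝ≥0
  continuous : Continuous toFun
  monotone : Monotone toFun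
  convex : ConvexOn ℝ≥0 Set.univ toFun
  map_zero : toFun 0 = 0
  tendsto_atTop : Tendsto toFun atTop atTop

section Orlicz

variable {Ω : Type*} [MeasurableSpace Ω]

/-- Atomless measures: every measurable set of positive measure has a measurable subset of
strictly smaller positive measure. (This is stronger than all singletons being null.) -/
def IsAtomless (P : Measure Ω) : Prop :=
  ∀ A : Set Ω, MeasurableSet A → 0 < P A →
    ∃ B : Set Ω, MeasurableSet B ∧ B ⊆ A ∧ 0 < P B ∧ P B < P A

/-- The Orlicz heart: the space of all (classes of a.s. equal) random variables `X` with
`E[Ψ(c|X|)] < ∞` for every `c > 0`. -/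
def orliczHeart (Ψ : YoungFunction) (P : Measure Ω) : Submodule ℝ (Ω →ₘ[P] ℝ) where
  carrier := {X | ∀ c : ℝ≥0, 0 < c → ∫⁻ ω, (Ψ.toFun (c * ‖X ω‖₊) : ℝ≥0∞) ∂P < ∞}
  zero_mem' := by
    intro c _
    have h : (fun ω => (Ψ.toFun (c * ‖(0 : Ω →ₘ[P] ℝ) ω‖₊) : ℝ≥0∞)) =ᵐ[P] fun _ => 0 := by
      filter_upwards [AEEqFun.coeFn_zero (α := Ω) (β := ℝ) (μ := P)] with ω hω
      simp [hω, Ψ.map_zero]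
    rw [lintegral_congr_ae h]
    simp
  add_mem' := by
    intro X Y hX hY c hc
    have h2 : (0 : ℝ≥0) < 2 * c := by positivity
    have key : ∀ᵐ ω ∂P, (Ψ.toFun (c * ‖(X + Y) ω‖₊) : ℝ≥0∞) ≤
        (Ψ.toFun (2 * c * ‖X ω‖₊) : ℝ≥0∞) + (Ψ.toFun (2 * c * ‖Y ω‖₊) : ℝ≥0∞) := by
      filter_upwards [AEEqFun.coeFn_add X Y] with ω hω
      rw [hω, Pi.add_apply]
      norm_cast
      have hle : c * ‖X ω + Y ω‖₊ ≤
          (2⁻¹ : ℝ≥0) • (2 * c * ‖X ω‖₊) + (2⁻¹ : ℝ≥0) • (2 * c * ‖Y ω‖₊) := by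
        have e : ∀ z : ℝ≥0, (2⁻¹ : ℝ≥0) • (2 * c * z) = c * z := by
          intro z
          rw [smul_eq_mul, mul_assoc, inv_mul_cancel_left₀ two_ne_zero]
        rw [e, e, ← mul_add]
        gcongr
        exact nnnorm_add_le _ _
      refine (Ψ.monotone hle).trans ?_
      refine (Ψ.convex.2 (Set.mem_univ _) (Set.mem_univ _) (by simp) (by simp)
        (by rw [← two_mul, mul_inv_cancel₀ two_ne_zero])).trans ?_
      have f : ∀ z : ℝ≥0, (2⁻¹ : ℝ≥0) • z ≤ z := by
        intro z
        rw [smul_eq_mul]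
        exact mul_le_of_le_one_left (by simp) (inv_le_one_of_one_le₀ one_le_two)
      exact add_le_add (f _) (f _)
    refine (lintegral_mono_ae key).trans_lt ?_
    rw [lintegral_add_left']
    · exact ENNReal.add_lt_top.2 ⟨hX _ h2, hY _ h2⟩
    · have hm : Measurable fun z : ℝ => (Ψ.toFun (2 * c * ‖z‖₊) : ℝ≥0∞) :=
        (ENNReal.continuous_coe.comp
          (Ψ.continuous.comp (continuous_const.mul continuous_nnnorm))).measurable
      exact hm.comp_aemeasurable X.aestronglyMeasurable.aemeasurable
  smul_mem' := by
    intro a X hX c hc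
    have h : (fun ω => (Ψ.toFun (c * ‖(a • X) ω‖₊) : ℝ≥0∞)) =ᵐ[P]
        fun ω => (Ψ.toFun (c * ‖a‖₊ * ‖X ω‖₊) : ℝ≥0∞) := by
      filter_upwards [AEEqFun.coeFn_smul a X] with ω hω
      rw [hω, Pi.smul_apply, nnnorm_smul, mul_assoc]
    rw [lintegral_congr_ae h]
    rcases eq_or_ne a 0 with rfl | ha
    · simp [Ψ.map_zero]
    · exact hX _ (mul_pos hc (nnnorm_pos.2 ha))

/-- A law-invariant convex risk measure on the Orlicz heart. Cash additivity is not required. -/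
structure RiskMeasure (Ψ : YoungFunction) (P : Measure Ω) where
  toFun : orliczHeart Ψ P → ℝ
  antitone : ∀ X Y : orliczHeart Ψ P,
    (X : Ω →ₘ[P] ℝ) ≤ᵐ[P] (Y : Ω →ₘ[P] ℝ) → toFun Y ≤ toFun X
  convex : ∀ (X Y : orliczHeart Ψ P) (l : ℝ), 0 ≤ l → l ≤ 1 →
    toFun (l • X + (1 - l) • Y) ≤ l * toFun X + (1 - l) * toFun Y
  law_invariant : ∀ X Y : orliczHeart Ψ P,
    P.map (X : Ω →ₘ[P] ℝ) = P.map (Y : Ω →ₘ[P] ℝ) → toFun X = toFun Y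

/-- The set of the distributions of all random variables from the Orlicz heart. -/
def laws (Ψ : YoungFunction) (P : Measure Ω) : Set (ProbabilityMeasure ℝ) :=
  {μ | ∃ X : orliczHeart Ψ P, P.map (X : Ω →ₘ[P] ℝ) = (μ : Measure ℝ)}

/-- The risk functional of `ρ`, which maps the law of `X` to `ρ X`; by law-invariance the
choice of `X` is irrelevant, see `riskFunctional_eq`. -/
def riskFunctional {Ψ : YoungFunction} {P : Measure Ω} (ρ : RiskMeasure Ψ P)
    (μ : laws Ψ P) : ℝ :=
  ρ.toFun μ.2.choose

theorem riskFunctional_eq {Ψ : YoungFunction} {P : Measure Ω} (ρ : RiskMeasure Ψ P)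
    (μ : laws Ψ P) (X : orliczHeart Ψ P)
    (hX : P.map (X : Ω →ₘ[P] ℝ) = ((μ : ProbabilityMeasure ℝ) : Measure ℝ)) :
    riskFunctional ρ μ = ρ.toFun X :=
  ρ.law_invariant _ _ (μ.2.choose_spec.trans hX.symm)

end Orlicz

/-! ### Fréchet classes and their images -/

/-- The Fréchet class: all Borel probability measures on `ℝ^d` with marginals `μ i`. -/
def frechetClass {d : ℕ} (μ : Fin d → ProbabilityMeasure ℝ) :
    Set (ProbabilityMeasure (Fin d → ℝ)) :=
  {m | ∀ i, (m : Measure (Fin d → ℝ)).map (fun x => x i) = (μ i : Measure ℝ)}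

/-- The set of the image measures under `A` of the members of the Fréchet class. -/
def frechetImage {d : ℕ} (μ : Fin d → ProbabilityMeasure ℝ) (A : (Fin d → ℝ) → ℝ) :
    Set (ProbabilityMeasure ℝ) :=
  {ν | ∃ m ∈ frechetClass μ, (ν : Measure ℝ) = (m : Measure (Fin d → ℝ)).map A}

end AggRobust

end

/-!
Weak continuity. If `∫ Ψ (c |X k - Y|) → 0` for all `c`, then along a fast subsequence `k j` the
supremum `W` of `(j + 1) |X (k j) - Y|` is in the Orlicz heart, and
`|X (k j) - Y| ≤ W / (j + 1)`. Monotonicity squeezes `ρ (X (k j))` between the values of `ρ` at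
`Y ± W / (j + 1)`, which converge to `ρ Y` because a finite convex function of one real variable is
continuous. On an atomless space, weakly convergent laws are realised by their quantile functions
at one uniform random variable, and these converge almost everywhere. Hence the risk functional is
continuous along weakly convergent laws whose `Ψ`-tails are uniformly small. The tails are uniformly
small on the image of a Fréchet class under a map `A` of linear growth: as
`|A x| ≤ b + c ∑ |x i|`, the value `Ψ (a |A x|)` is bounded in terms of `Ψ` at multiples of the
single `|x i|`, whose laws are fixed.

Robustness. Applying the quantile functions to one sequence of independent uniform variables
couples the samples of all laws at once. For `ν k → μ`, the expected mean modular of the difference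
of the first `n k` observations from `ν k` and from `μ` does not depend on `n k` and tends to `0`.
Along a subsequence the mean modular tends to `0` almost surely, and `n k` is constant or tends to
infinity. In both cases the empirical measures of `μ` converge with uniformly small tails, in the
second one by the strong law of large numbers, so the two estimates merge.
-/

noncomputable section

namespace AggRobust

section MeasureChain

variable {Ω : Type*} [MeasurableSpace Ω] {P : Measure Ω}

/-- A family of measurable sets which inclusion orders totally, and in the same way as `P`. -/
def IsMeasureChain (P : Measure Ω) (C : Set (Set Ω)) : Prop :=
  (∀ B ∈ C, MeasurableSet B) ∧ ∀ B ∈ C, ∀ B' ∈ C, P B ≤ P B' → B ⊆ B'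

theorem IsMeasureChain.mono {C C' : Set (Set Ω)} (hC : IsMeasureChain P C) (h : C' ⊆ C) :
    IsMeasureChain P C' :=
  ⟨fun B hB => hC.1 B (h hB), fun B hB B' hB' => hC.2 B (h hB) B' (h hB')⟩

theorem IsMeasureChain.insert {C : Set (Set Ω)} (hC : IsMeasureChain P C) {E : Set Ω}
    (hE : MeasurableSet E) (h : ∀ B ∈ C, B ⊆ E ∧ P B < P E ∨ E ⊆ B ∧ P E < P B) :
    IsMeasureChain P (insert E C) := by
  refine ⟨Set.forall_mem_insert.2 ⟨hE, hC.1⟩, ?_⟩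
  rintro B (rfl | hB) B' (rfl | hB') hle
  · exact subset_rfl
  · exact (h B' hB').elim (fun h => absurd hle h.2.not_ge) And.left
  · exact (h B hB).elim And.left fun h => absurd hle h.2.not_ge
  · exact hC.2 B hB B' hB' hle

theorem IsMeasureChain.image_compl [IsProbabilityMeasure P] {C : Set (Set Ω)}
    (hC : IsMeasureChain P C) : IsMeasureChain P (compl '' C) := by
  refine ⟨Set.forall_mem_image.2 fun B hB => (hC.1 B hB).compl, ?_⟩
  rintro _ ⟨B, hB, rfl⟩ _ ⟨B', hB', rfl⟩ hle
  rw [prob_compl_eq_one_sub (hC.1 B hB), prob_compl_eq_one_sub (hC.1 B' hB')] at hle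
  exact Set.compl_subset_compl.2 <| hC.2 B' hB' B hB <|
    (ENNReal.sub_le_sub_iff_left prob_le_one ENNReal.one_ne_top).1 hle

theorem exists_maximal_isMeasureChain (P : Measure Ω) :
    ∃ C : Set (Set Ω), Maximal (IsMeasureChain P) C := by
  refine zorn_subset {C | IsMeasureChain P C} fun c hc hchain =>
    ⟨⋃₀ c, ⟨?_, ?_⟩, fun C => Set.subset_sUnion_of_mem⟩
  · rintro B ⟨C, hC, hB⟩
    exact (hc hC).1 B hB
  · rintro B ⟨C, hC, hB⟩ B' ⟨C', hC', hB'⟩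
    obtain ⟨D, hD, hCD, hCD'⟩ := hchain.directedOn C hC C' hC'
    exact (hc hD).2 B (hCD hB) B' (hCD' hB')

/-- Although the chain may be uncountable, a sequence along which the measures converge to their
supremum already exhausts it. -/
theorem IsMeasureChain.exists_isLUB {C : Set (Set Ω)} (hC : IsMeasureChain P C) {t : ℝ≥0∞}
    (ht : ∀ B ∈ C, P B ≤ t) : ∃ D, MeasurableSet D ∧ P D ≤ t ∧ IsLUB C D := by
  rcases C.eq_empty_or_nonempty with rfl | hne
  · exact ⟨∅, MeasurableSet.empty, by simp, by simp⟩
  by_cases hmax : ∃ D ∈ C, ∀ B ∈ C, P B ≤ P D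
  · obtain ⟨D, hD, hDmax⟩ := hmax
    exact ⟨D, hC.1 D hD, ht D hD, fun B hB => hC.2 B hB D hD (hDmax B hB), fun E hE => hE hD⟩
  push Not at hmax
  obtain ⟨u, -, hu, huC⟩ := exists_seq_tendsto_sSup (hne.image P) (OrderTop.bddAbove _)
  choose D hDC hDu using huC
  have hdir : Directed (· ⊆ ·) D := fun i j =>
    (le_total (P (D i)) (P (D j))).elim
      (fun h => ⟨j, hC.2 _ (hDC i) _ (hDC j) h, subset_rfl⟩)
      fun h => ⟨i, subset_rfl, hC.2 _ (hDC j) _ (hDC i) h⟩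
  refine ⟨⋃ n, D n, MeasurableSet.iUnion fun n => hC.1 _ (hDC n), ?_, fun B hB => ?_,
    fun E hE => Set.iUnion_subset fun n => hE (hDC n)⟩
  · rw [hdir.measure_iUnion]
    exact iSup_le fun n => ht _ (hDC n)
  · obtain ⟨B', hB', hlt⟩ := hmax B hB
    have hsup : P B < sSup (P '' C) := hlt.trans_le (le_sSup ⟨B', hB', rfl⟩)
    obtain ⟨n, hn⟩ := (hu.eventually_const_lt hsup).exists
    exact (hC.2 B hB _ (hDC n) (hDu n ▸ hn.le)).trans (Set.subset_iUnion D n)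

theorem IsMeasureChain.exists_separating [IsProbabilityMeasure P] {C : Set (Set Ω)}
    (hC : IsMeasureChain P C) {t : ℝ≥0∞} (ht : t ≤ 1) :
    ∃ L V, MeasurableSet L ∧ MeasurableSet V ∧ L ⊆ V ∧ P L ≤ t ∧ t ≤ P V ∧
      (∀ B ∈ C, P B < t → B ⊆ L) ∧ ∀ B ∈ C, t < P B → V ⊆ B := by
  have hlow : IsMeasureChain P {B ∈ C | P B < t} := hC.mono fun _ => And.left
  have hupp : IsMeasureChain P {B ∈ C | t < P B} := hC.mono fun _ => And.left
  obtain ⟨L, hL, hLt, hLub⟩ := hlow.exists_isLUB fun B hB => hB.2.le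
  obtain ⟨W, hW, hWt, hWub⟩ := hupp.image_compl.exists_isLUB (t := 1 - t) <| by
    rintro _ ⟨B, hB, rfl⟩
    rw [prob_compl_eq_one_sub (hC.1 B hB.1)]
    exact tsub_le_tsub_left hB.2.le 1
  refine ⟨L, Wᶜ, hL, hW.compl, ?_, hLt, ?_, fun B hB h => hLub.1 ⟨hB, h⟩, fun B hB h =>
    Set.compl_subset_comm.1 (hWub.1 ⟨B, ⟨hB, h⟩, rfl⟩)⟩
  · refine hLub.2 fun B hB => Set.subset_compl_comm.1 (hWub.2 ?_)
    rintro _ ⟨B', hB', rfl⟩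
    exact Set.compl_subset_compl.2 (hC.2 B hB.1 B' hB'.1 (hB.2.trans hB'.2).le)
  · rw [prob_compl_eq_one_sub hW]
    exact ENNReal.le_sub_of_add_le_left (ne_top_of_le_ne_top (by simp) hWt)
      ((add_le_add_left hWt t).trans (tsub_add_cancel_of_le ht).le)

theorem IsAtomless.exists_between [IsFiniteMeasure P] (hP : IsAtomless P) {L V : Set Ω}
    (hL : MeasurableSet L) (hV : MeasurableSet V) (hLV : L ⊆ V) (hlt : P L < P V) :
    ∃ E, MeasurableSet E ∧ L ⊆ E ∧ E ⊆ V ∧ P L < P E ∧ P E < P V := by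
  have hdiff : P L + P (V \ L) = P V := by
    rw [← measure_union Set.disjoint_sdiff_right (hV.diff hL), Set.union_sdiff_cancel hLV]
  have hpos : 0 < P (V \ L) := by
    refine pos_iff_ne_zero.2 fun h => hlt.ne ?_
    rw [← hdiff, h, add_zero]
  obtain ⟨D, hD, hDsub, hD0, hD1⟩ := hP _ (hV.diff hL) hpos
  have hLD : P (L ∪ D) = P L + P D :=
    measure_union (Set.disjoint_sdiff_right.mono_right hDsub) hD
  refine ⟨L ∪ D, hL.union hD, Set.subset_union_left,
    Set.union_subset hLV (hDsub.trans Set.sdiff_subset), ?_, ?_⟩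
  · rw [hLD]
    exact ENNReal.lt_add_right (measure_ne_top _ _) hD0.ne'
  · rw [hLD, ← hdiff]
    exact ENNReal.add_lt_add_left (measure_ne_top _ _) hD1

theorem IsAtomless.exists_measure_eq_of_maximal [IsProbabilityMeasure P] (hP : IsAtomless P)
    {C : Set (Set Ω)} (hC : Maximal (IsMeasureChain P) C) {t : ℝ≥0∞} (ht : t ≤ 1) :
    ∃ B ∈ C, P B = t := by
  by_contra! hne
  obtain ⟨L, V, hL, hV, hLV, hLt, htV, hCL, hCV⟩ := hC.prop.exists_separating ht
  have hmem : ∀ E, MeasurableSet E → L ⊆ E → E ⊆ V → P E = t ∨ P L < P E ∧ P E < P V → E ∈ C := by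
    intro E hE hLE hEV hPE
    refine hC.le_of_ge (hC.prop.insert hE fun B hB => ?_) (Set.subset_insert E C)
      (Set.mem_insert E C)
    rcases (hne B hB).lt_or_gt with h | h
    · have hBL := hCL B hB h
      exact Or.inl ⟨hBL.trans hLE, hPE.elim (fun e => e ▸ h)
        fun e => (measure_mono hBL).trans_lt e.1⟩
    · have hVB := hCV B hB h
      exact Or.inr ⟨hEV.trans hVB, hPE.elim (fun e => e ▸ h)
        fun e => e.2.trans_le (measure_mono hVB)⟩
  rcases (measure_mono hLV : P L ≤ P V).eq_or_lt with heq | hlt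
  · have hLeq : P L = t := le_antisymm hLt (heq ▸ htV)
    exact hne L (hmem L hL subset_rfl hLV (Or.inl hLeq)) hLeq
  · obtain ⟨E, hE, hLE, hEV, hPL, hPV⟩ := hP.exists_between hL hV hLV hlt
    have hEC : E ∈ C := hmem E hE hLE hEV (Or.inr ⟨hPL, hPV⟩)
    rcases (hne E hEC).lt_or_gt with h | h
    · exact (measure_mono (hCL E hEC h)).not_gt hPL
    · exact (measure_mono (hCV E hEC h)).not_gt hPV

end MeasureChain

section Uniform

variable {Ω : Type*} [MeasurableSpace Ω] {P : Measure Ω}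

/-- The uniform distribution on the unit interval. The interval is open so that every `u` in it is
the level of a quantile. -/
def unif : Measure ℝ := volume.restrict (Set.Ioo 0 1)

instance : IsProbabilityMeasure unif := ⟨by simp [unif]⟩

theorem eq_unif_of_measure_Iio {μ : Measure ℝ} [IsProbabilityMeasure μ]
    (h : ∀ s ≤ 1, μ (Set.Iio s) = ENNReal.ofReal s) : μ = unif := by
  have hμ (s : ℝ) : μ (Set.Iio s) = unif (Set.Iio s) := by
    rw [unif, Measure.restrict_apply measurableSet_Iio, Set.inter_comm, ← Set.Ioi_inter_Iio,
      Set.inter_assoc, Set.Iio_inter_Iio, Set.Ioi_inter_Iio, Real.volume_Ioo, sub_zero]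
    rcases le_total s 1 with hs | hs
    · rw [h s hs, min_eq_right hs]
    · refine le_antisymm (prob_le_one.trans_eq ?_) ?_
      · simp [hs]
      · rw [min_eq_left hs, ← h 1 le_rfl]
        exact measure_mono (Set.Iio_subset_Iio hs)
  refine Measure.ext_of_Ici _ _ fun s => ?_
  rw [← Set.compl_Iio, prob_compl_eq_one_sub measurableSet_Iio,
    prob_compl_eq_one_sub measurableSet_Iio, hμ]

theorem exists_measurable_measure_lt_eq {B : ℚ → Set Ω} (hBm : ∀ q, MeasurableSet (B q))
    (hB : Monotone B) (hPB : ∀ q : ℚ, P (B q) = min (ENNReal.ofReal q) 1) :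
    ∃ V : Ω → ℝ≥0∞, Measurable V ∧ (∀ ω, V ω ≤ 1) ∧ ∀ s ≤ 1, P {ω | V ω < s} = s := by
  classical
  refine ⟨fun ω => ⨅ q : ℚ, if ω ∈ B q then ENNReal.ofReal q else 1,
    Measurable.iInf fun q => Measurable.ite (hBm q) measurable_const measurable_const,
    fun ω => (iInf_le _ 0).trans (by split_ifs <;> simp), fun s hs => ?_⟩
  have hset : {ω | ⨅ q : ℚ, (if ω ∈ B q then ENNReal.ofReal q else 1) < s} =
      ⋃ q : {q : ℚ // ENNReal.ofReal q < s}, B q := by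
    ext ω
    simp only [Set.mem_ofPred_eq, iInf_lt_iff, Set.mem_iUnion, Subtype.exists, exists_prop]
    refine exists_congr fun q => ?_
    split_ifs with h <;> simp [h, hs]
  have hdir : Directed (· ⊆ ·) fun q : {q : ℚ // ENNReal.ofReal q < s} => B q :=
    (hB.comp (Subtype.mono_coe _)).directed_le
  rw [hset, hdir.measure_iUnion]
  refine le_antisymm (iSup_le fun q => ?_) (le_of_forall_lt fun c hc => ?_)
  · rw [hPB]
    exact (min_le_left _ _).trans q.2.le
  · obtain ⟨q, -, hcq, hqs⟩ := ENNReal.lt_iff_exists_rat_btwn.1 hc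
    calc c < P (B q) := by rw [hPB]; exact lt_min hcq (hc.trans_le hs)
      _ ≤ _ := le_iSup (fun q : {q : ℚ // ENNReal.ofReal q < s} => P (B q)) ⟨q, hqs⟩

theorem IsAtomless.exists_uniform [IsProbabilityMeasure P] (hP : IsAtomless P) :
    ∃ U : Ω → ℝ, Measurable U ∧ P.map U = unif := by
  obtain ⟨C, hC⟩ := exists_maximal_isMeasureChain P
  choose B hBC hPB using fun q : ℚ =>
    hP.exists_measure_eq_of_maximal hC (min_le_right (ENNReal.ofReal q) 1)
  have hB : Monotone B := fun p q h => hC.prop.2 _ (hBC p) _ (hBC q) <| by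
    rw [hPB, hPB]
    gcongr
  obtain ⟨V, hV, hV1, hPV⟩ := exists_measurable_measure_lt_eq (fun q => hC.prop.1 _ (hBC q)) hB hPB
  have hU : Measurable fun ω => (V ω).toReal := hV.ennreal_toReal
  have : IsProbabilityMeasure (P.map fun ω => (V ω).toReal) :=
    Measure.isProbabilityMeasure_map hU.aemeasurable
  refine ⟨_, hU, eq_unif_of_measure_Iio fun s hs => ?_⟩
  rw [Measure.map_apply hU measurableSet_Iio, ← hPV _ (ENNReal.ofReal_le_one.2 hs)]
  congr 1
  ext ω
  exact (ENNReal.lt_ofReal_iff_toReal_lt (ne_top_of_le_ne_top ENNReal.one_ne_top (hV1 ω))).symm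

end Uniform

section Quantile

open ProbabilityTheory

theorem unif_Iic {c : ℝ} (hc : c ≤ 1) : unif (Set.Iic c) = ENNReal.ofReal c := by
  rw [unif, restrict_Ioo_eq_restrict_Ioc, Measure.restrict_apply measurableSet_Iic,
    Set.inter_comm, Set.Ioc_inter_Iic, min_eq_right hc, Real.volume_Ioc, sub_zero]

/-- The lower quantile function of `ν`, extended by `0` outside the open unit interval, where the
infimum may have a junk value. -/
def quantile (ν : Measure ℝ) : ℝ → ℝ :=
  (Set.Ioo 0 1).indicator fun u => sInf {x | u ≤ cdf ν x}

theorem quantile_le_iff (ν : Measure ℝ) {u : ℝ} (hu : u ∈ Set.Ioo 0 1) (x : ℝ) :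
    quantile ν u ≤ x ↔ u ≤ cdf ν x := by
  have hne : {x | u ≤ cdf ν x}.Nonempty :=
    ((tendsto_cdf_atTop ν).eventually_const_le hu.2).exists
  have hbdd : BddBelow {x | u ≤ cdf ν x} := by
    obtain ⟨y, hy⟩ := ((tendsto_cdf_atBot ν).eventually_lt_const hu.1).exists
    exact ⟨y, fun x hx => le_of_not_gt fun h => (hx.trans (monotone_cdf ν h.le)).not_gt hy⟩
  rw [quantile, Set.indicator_of_mem hu]
  refine ⟨fun h => ?_, fun h => csInf_le hbdd h⟩
  have hright : Tendsto (cdf ν) (𝓝[>] x) (𝓝 (cdf ν x)) :=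
    ((cdf ν).right_continuous x).tendsto.mono_left (nhdsWithin_mono _ Set.Ioi_subset_Ici_self)
  refine ge_of_tendsto hright (eventually_mem_nhdsWithin.mono fun y hy => ?_)
  obtain ⟨z, hz, hzy⟩ := (csInf_lt_iff hbdd hne).1 (h.trans_lt hy)
  exact le_trans hz (monotone_cdf ν hzy.le)

theorem quantile_le_iff_ofReal_le (ν : Measure ℝ) [IsProbabilityMeasure ν] {u : ℝ}
    (hu : u ∈ Set.Ioo 0 1) (x : ℝ) : quantile ν u ≤ x ↔ ENNReal.ofReal u ≤ ν (Set.Iic x) := by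
  rw [quantile_le_iff ν hu, ← ofReal_cdf, ENNReal.ofReal_le_ofReal_iff (cdf_nonneg ν x)]

theorem monotoneOn_quantile (ν : Measure ℝ) : MonotoneOn (quantile ν) (Set.Ioo 0 1) :=
  fun _ hu _ hv huv => (quantile_le_iff ν hu _).2 (huv.trans ((quantile_le_iff ν hv _).1 le_rfl))

@[fun_prop]
theorem measurable_quantile (ν : Measure ℝ) : Measurable (quantile ν) := by
  have hzero : (Set.Ioo 0 1)ᶜ.domRestrict (quantile ν) = 0 :=
    funext fun u => Set.indicator_of_notMem (f := fun u => sInf {x | u ≤ cdf ν x}) u.2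
  refine measurable_of_restrict_of_restrict_compl measurableSet_Ioo
    (monotoneOn_quantile ν).monotone.measurable ?_
  rw [hzero]
  exact measurable_zero

theorem map_quantile (ν : Measure ℝ) [IsProbabilityMeasure ν] : unif.map (quantile ν) = ν := by
  have : IsProbabilityMeasure (unif.map (quantile ν)) :=
    Measure.isProbabilityMeasure_map (measurable_quantile ν).aemeasurable
  refine Measure.ext_of_Iic _ _ fun x => ?_
  rw [Measure.map_apply (measurable_quantile ν) measurableSet_Iic, ← ofReal_cdf,
    ← unif_Iic (cdf_le_one ν x)]
  refine measure_congr ?_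
  filter_upwards [ae_restrict_mem measurableSet_Ioo] with u hu
  exact propext (quantile_le_iff ν hu x)

theorem ae_continuousAt_quantile (ν : Measure ℝ) : ∀ᵐ u ∂unif, ContinuousAt (quantile ν) u := by
  have hnull := (monotoneOn_quantile ν).countable_not_continuousWithinAt.measure_zero volume
  filter_upwards [ae_restrict_of_ae (measure_eq_zero_iff_ae_notMem.1 hnull),
    ae_restrict_mem measurableSet_Ioo] with u hu hu01
  have hcont : ContinuousWithinAt (quantile ν) (Set.Ioo 0 1) u := by
    by_contra h
    exact hu ⟨hu01, h⟩
  exact hcont.continuousAt (Ioo_mem_nhds hu01.1 hu01.2)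

theorem ae_tendsto_quantile {ι : Type*} {l : Filter ι} {ν : ι → ProbabilityMeasure ℝ}
    {μ : ProbabilityMeasure ℝ} (h : Tendsto ν l (𝓝 μ)) :
    ∀ᵐ u ∂unif, Tendsto (fun i => quantile (ν i) u) l (𝓝 (quantile μ u)) := by
  filter_upwards [ae_continuousAt_quantile μ, ae_restrict_mem measurableSet_Ioo]
    with u hcont hu
  refine tendsto_order.2 ⟨fun a ha => ?_, fun a ha => ?_⟩
  · have hlt : (μ : Measure ℝ) (Set.Iic a) < ENNReal.ofReal u :=
      not_le.1 fun hle => ((quantile_le_iff_ofReal_le _ hu a).2 hle).not_gt ha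
    filter_upwards [eventually_lt_of_limsup_lt
      ((ProbabilityMeasure.limsup_measure_closed_le_of_tendsto h isClosed_Iic).trans_lt hlt)]
      with i hi
    exact not_le.1 fun hle => ((quantile_le_iff_ofReal_le _ hu a).1 hle).not_gt hi
  · obtain ⟨v, ⟨hva, hv1⟩, huv⟩ : ∃ v, (quantile μ v < a ∧ v < 1) ∧ u < v :=
      ((((hcont.eventually_lt_const ha).and (eventually_lt_nhds hu.2)).filter_mono
        nhdsWithin_le_nhds).and (eventually_mem_nhdsWithin (s := Set.Ioi u))).exists
    have hv : v ∈ Set.Ioo 0 1 := ⟨hu.1.trans huv, hv1⟩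
    obtain ⟨b, hvb, hba⟩ := exists_between hva
    have hlt : ENNReal.ofReal u < (μ : Measure ℝ) (Set.Iio b) :=
      calc ENNReal.ofReal u < ENNReal.ofReal v := (ENNReal.ofReal_lt_ofReal_iff hv.1).2 huv
        _ ≤ (μ : Measure ℝ) (Set.Iic (quantile μ v)) :=
          (quantile_le_iff_ofReal_le _ hv _).1 le_rfl
        _ ≤ _ := measure_mono (Set.Iic_subset_Iio.2 hvb)
    filter_upwards [eventually_lt_of_lt_liminf
      (hlt.trans_le (ProbabilityMeasure.le_liminf_measure_open_of_tendsto h isOpen_Iio))]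
      with i hi
    exact ((quantile_le_iff_ofReal_le _ hu b).2
      (hi.le.trans (measure_mono Set.Iio_subset_Iic_self))).trans_lt hba

theorem lintegral_quantile (μ : Measure ℝ) [IsProbabilityMeasure μ] {f : ℝ → ℝ≥0∞}
    (hf : Measurable f) : ∫⁻ u, f (quantile μ u) ∂unif = ∫⁻ y, f y ∂μ := by
  rw [← lintegral_map hf (measurable_quantile μ), map_quantile]

end Quantile

section Modular

namespace YoungFunction

variable (Ψ : YoungFunction)

/-- The modular integrand `y ↦ Ψ (c |y|)`, with values in `ℝ≥0∞` as needed for integration. -/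
def scaled (c : ℝ≥0) (y : ℝ) : ℝ≥0∞ := Ψ.toFun (c * ‖y‖₊)

theorem continuous_scaled (c : ℝ≥0) : Continuous (Ψ.scaled c) :=
  ENNReal.continuous_coe.comp (Ψ.continuous.comp (continuous_const.mul continuous_nnnorm))

@[fun_prop]
theorem measurable_scaled (c : ℝ≥0) : Measurable (Ψ.scaled c) :=
  (Ψ.continuous_scaled c).measurable

theorem scaled_ne_top (c : ℝ≥0) (y : ℝ) : Ψ.scaled c y ≠ ∞ := ENNReal.coe_ne_top

@[simp]
theorem scaled_zero_left (y : ℝ) : Ψ.scaled 0 y = 0 := by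
  simp [scaled, Ψ.map_zero]

@[simp]
theorem scaled_zero_right (c : ℝ≥0) : Ψ.scaled c 0 = 0 := by
  simp [scaled, Ψ.map_zero]

theorem scaled_le_scaled {c c' : ℝ≥0} {x y : ℝ} (h : c * ‖x‖₊ ≤ c' * ‖y‖₊) :
    Ψ.scaled c x ≤ Ψ.scaled c' y :=
  ENNReal.coe_le_coe.2 (Ψ.monotone h)

theorem scaled_neg (c : ℝ≥0) (y : ℝ) : Ψ.scaled c (-y) = Ψ.scaled c y := by
  simp [scaled]

theorem scaled_mul (c : ℝ≥0) (a y : ℝ) : Ψ.scaled c (a * y) = Ψ.scaled (c * ‖a‖₊) y := by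
  simp [scaled, mul_assoc]

theorem scaled_add_le_max (c : ℝ≥0) (x y : ℝ) :
    Ψ.scaled c (x + y) ≤ max (Ψ.scaled (2 * c) x) (Ψ.scaled (2 * c) y) := by
  have hadd : c * ‖x + y‖₊ ≤ c * ‖x‖₊ + c * ‖y‖₊ := by
    rw [← mul_add]
    gcongr
    exact nnnorm_add_le x y
  rcases le_total ‖x‖₊ ‖y‖₊ with h | h
  · refine le_max_of_le_right (Ψ.scaled_le_scaled (hadd.trans ?_))
    rw [mul_assoc, two_mul]
    gcongr
  · refine le_max_of_le_left (Ψ.scaled_le_scaled (hadd.trans ?_))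
    rw [mul_assoc, two_mul]
    gcongr

theorem scaled_add_tsub_le (c : ℝ≥0) (x y : ℝ) (R : ℝ≥0∞) :
    Ψ.scaled c (x + y) - R ≤ (Ψ.scaled (2 * c) x - R) + (Ψ.scaled (2 * c) y - R) :=
  calc Ψ.scaled c (x + y) - R
      ≤ max (Ψ.scaled (2 * c) x) (Ψ.scaled (2 * c) y) - R := by
        gcongr
        exact Ψ.scaled_add_le_max c x y
    _ = max (Ψ.scaled (2 * c) x - R) (Ψ.scaled (2 * c) y - R) :=
        Monotone.map_max fun _ _ h => tsub_le_tsub_right h R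
    _ ≤ _ := max_le_add_of_nonneg (by simp) (by simp)

theorem scaled_sub_tsub_le (c : ℝ≥0) (x y : ℝ) (R : ℝ≥0∞) :
    Ψ.scaled c (x - y) - R ≤ (Ψ.scaled (2 * c) x - R) + (Ψ.scaled (2 * c) y - R) := by
  simpa only [sub_eq_add_neg, scaled_neg] using Ψ.scaled_add_tsub_le c x (-y) R

/-- Integrability of the identity in the Orlicz sense, for all scales `c` as in the definition of
the Orlicz heart. -/
def HasFiniteMoments (μ : Measure ℝ) : Prop := ∀ c : ℝ≥0, ∫⁻ y, Ψ.scaled c y ∂μ < ∞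

/-- Asymptotically uniform smallness of the tails of all moments along the filter `l`. The tail
above the level `R` is measured by the excess over `R`, which depends continuously on `y`. -/
def UniformTails {ι : Type*} (ν : ι → ProbabilityMeasure ℝ) (l : Filter ι) : Prop :=
  ∀ (c : ℝ≥0) (ε : ℝ≥0∞), 0 < ε → ∃ R : ℝ≥0, ∀ᶠ i in l,
    ∫⁻ y, (Ψ.scaled c y - R) ∂(ν i : Measure ℝ) ≤ ε

end YoungFunction

theorem tendsto_lintegral_tsub_natCast {α : Type*} [MeasurableSpace α] {μ : Measure α}
    {f : α → ℝ≥0∞} (hf : Measurable f) (hfin : ∫⁻ a, f a ∂μ ≠ ∞) :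
    Tendsto (fun R : ℕ => ∫⁻ a, (f a - R) ∂μ) atTop (𝓝 0) := by
  rw [← lintegral_zero (μ := μ)]
  refine tendsto_lintegral_of_dominated_convergence f (fun R => hf.sub_const _)
    (fun R => ae_of_all _ fun a => tsub_le_self) hfin ?_
  filter_upwards [ae_lt_top hf hfin] with a ha
  obtain ⟨N, hN⟩ := ENNReal.exists_nat_gt ha.ne
  refine tendsto_const_nhds.congr' ?_
  filter_upwards [eventually_ge_atTop N] with R hR
  exact (tsub_eq_zero_of_le (hN.le.trans (by gcongr))).symm

theorem tendsto_lintegral_zero_of_ae_of_tsub {α ι : Type*} [MeasurableSpace α] {μ : Measure α}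
    [IsFiniteMeasure μ] {l : Filter ι} [l.IsCountablyGenerated] {f : ι → α → ℝ≥0∞}
    (hf : ∀ i, Measurable (f i)) (hlim : ∀ᵐ a ∂μ, Tendsto (fun i => f i a) l (𝓝 0))
    (htail : ∀ ε : ℝ≥0∞, 0 < ε → ∃ R : ℝ≥0, ∀ᶠ i in l, ∫⁻ a, (f i a - R) ∂μ ≤ ε) :
    Tendsto (fun i => ∫⁻ a, f i a ∂μ) l (𝓝 0) := by
  refine ENNReal.tendsto_nhds_zero.2 fun ε hε => ?_
  obtain ⟨R, hR⟩ := htail (ε / 2) (ENNReal.half_pos hε.ne')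
  have htrunc : Tendsto (fun i => ∫⁻ a, min (f i a) R ∂μ) l (𝓝 0) := by
    rw [← lintegral_zero (μ := μ)]
    refine tendsto_lintegral_filter_of_dominated_convergence (fun _ => R)
      (Eventually.of_forall fun i => (hf i).min measurable_const)
      (Eventually.of_forall fun i => ae_of_all _ fun a => min_le_right _ _)
      (by simp [ENNReal.mul_eq_top]) ?_
    filter_upwards [hlim] with a ha
    simpa using ha.min (tendsto_const_nhds (x := (R : ℝ≥0∞)))
  filter_upwards [hR, ENNReal.tendsto_nhds_zero.1 htrunc _ (ENNReal.half_pos hε.ne')] with i h₁ h₂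
  calc ∫⁻ a, f i a ∂μ
      = ∫⁻ a, ((f i a - R) + min (f i a) R) ∂μ := by simp only [tsub_add_min]
    _ = ∫⁻ a, (f i a - R) ∂μ + ∫⁻ a, min (f i a) R ∂μ :=
        lintegral_add_left ((hf i).sub_const _) _
    _ ≤ ε / 2 + ε / 2 := add_le_add h₁ h₂
    _ = ε := ENNReal.add_halves ε

namespace YoungFunction

variable {Ψ : YoungFunction}

theorem HasFiniteMoments.uniformTails_const {μ : ProbabilityMeasure ℝ}
    (hμ : Ψ.HasFiniteMoments μ) {ι : Type*} (l : Filter ι) : Ψ.UniformTails (fun _ => μ) l := by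
  intro c ε hε
  obtain ⟨R, hR⟩ := ((tendsto_lintegral_tsub_natCast (Ψ.measurable_scaled c)
    (hμ c).ne).eventually_le_const hε).exists
  exact ⟨R, Eventually.of_forall fun _ => by simpa using hR⟩

theorem UniformTails.comp {ι κ : Type*} {ν : ι → ProbabilityMeasure ℝ} {l : Filter ι}
    (h : Ψ.UniformTails ν l) {k : Filter κ} {g : κ → ι} (hg : Tendsto g k l) :
    Ψ.UniformTails (ν ∘ g) k := fun c ε hε =>
  (h c ε hε).imp fun _ hR => hg.eventually hR

theorem tendsto_lintegral_quantile_sub {ι : Type*} {l : Filter ι} [l.IsCountablyGenerated]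
    {ν : ι → ProbabilityMeasure ℝ} {μ : ProbabilityMeasure ℝ} (hlim : Tendsto ν l (𝓝 μ))
    (hν : Ψ.UniformTails ν l) (hμ : Ψ.HasFiniteMoments μ) (c : ℝ≥0) :
    Tendsto (fun i => ∫⁻ u, Ψ.scaled c (quantile (ν i) u - quantile μ u) ∂unif) l (𝓝 0) := by
  have hmeas (m : ProbabilityMeasure ℝ) (R : ℝ≥0∞) :
      Measurable fun u => Ψ.scaled (2 * c) (quantile m u) - R :=
    ((Ψ.measurable_scaled _).comp (measurable_quantile m)).sub_const _
  refine tendsto_lintegral_zero_of_ae_of_tsub (fun i => (Ψ.measurable_scaled c).comp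
    ((measurable_quantile _).sub (measurable_quantile _))) ?_ fun ε hε => ?_
  · filter_upwards [ae_tendsto_quantile hlim] with u hu
    have hdiff : Tendsto (fun i => quantile (ν i) u - quantile μ u) l (𝓝 0) := by
      simpa using hu.sub_const (quantile μ u)
    simpa [Function.comp_def] using ((Ψ.continuous_scaled c).tendsto 0).comp hdiff
  · obtain ⟨R, hR⟩ := hν (2 * c) (ε / 2) (ENNReal.half_pos hε.ne')
    obtain ⟨R', hR'⟩ := hμ.uniformTails_const l (2 * c) (ε / 2) (ENNReal.half_pos hε.ne')
    refine ⟨max R R', ?_⟩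
    filter_upwards [hR, hR'] with i hi hi'
    calc ∫⁻ u, (Ψ.scaled c (quantile (ν i) u - quantile μ u) - (max R R' : ℝ≥0)) ∂unif
        ≤ ∫⁻ u, ((Ψ.scaled (2 * c) (quantile (ν i) u) - R) +
            (Ψ.scaled (2 * c) (quantile μ u) - R')) ∂unif := by
          refine lintegral_mono fun u => (Ψ.scaled_sub_tsub_le c _ _ _).trans ?_
          gcongr
          exacts [le_max_left _ _, le_max_right _ _]
      _ = ∫⁻ y, (Ψ.scaled (2 * c) y - R) ∂(ν i : Measure ℝ) +
            ∫⁻ y, (Ψ.scaled (2 * c) y - R') ∂(μ : Measure ℝ) := by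
          rw [lintegral_add_left (hmeas _ _),
            lintegral_quantile (ν i : Measure ℝ) ((Ψ.measurable_scaled _).sub_const _),
            lintegral_quantile (μ : Measure ℝ) ((Ψ.measurable_scaled _).sub_const _)]
      _ ≤ ε := (add_le_add hi hi').trans_eq (ENNReal.add_halves ε)

end YoungFunction

end Modular

section Domination

variable {Ω : Type*} [MeasurableSpace Ω] {P : Measure Ω} {Ψ : YoungFunction}

theorem tsum_lt_top_of_eventually_le_geometric {a : ℕ → ℝ≥0∞} (hfin : ∀ j, a j ≠ ∞)
    (ha : ∀ᶠ j in atTop, a j ≤ 2⁻¹ ^ j) : ∑' j, a j < ∞ := by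
  lift a to ℕ → ℝ≥0 using hfin
  refine (ENNReal.tsum_coe_ne_top_iff_summable.2 (NNReal.summable_coe.1 ?_)).lt_top
  refine Summable.of_norm_bounded_eventually_nat (g := fun j => (2⁻¹ : ℝ) ^ j)
    (summable_geometric_of_lt_one (by norm_num) (by norm_num)) ?_
  filter_upwards [ha] with j hj
  have hj' : a j ≤ (2⁻¹ : ℝ≥0) ^ j := by
    rw [← ENNReal.coe_le_coe, ENNReal.coe_pow, ENNReal.coe_inv two_ne_zero]
    exact hj
  simpa using NNReal.coe_le_coe.2 hj'

theorem exists_subseq_tsum_lt_top {F : ℝ≥0 → ℕ → ℝ≥0∞} (hmono : ∀ k, Monotone fun c => F c k)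
    (hfin : ∀ c k, F c k ≠ ∞) (hlim : ∀ c, Tendsto (F c) atTop (𝓝 0)) :
    ∃ φ : ℕ → ℕ, StrictMono φ ∧ ∀ c : ℝ≥0, ∑' j : ℕ, F (c * (j + 1)) (φ j) < ∞ := by
  obtain ⟨φ, hφ, hle⟩ := extraction_forall_of_eventually fun j : ℕ =>
    (hlim ((j + 1) * (j + 1))).eventually_le_const (ENNReal.pow_pos (by simp : (0 : ℝ≥0∞) < 2⁻¹) j)
  refine ⟨φ, hφ, fun c => tsum_lt_top_of_eventually_le_geometric (fun j => hfin _ _) ?_⟩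
  obtain ⟨N, hN⟩ := exists_nat_ge c
  filter_upwards [eventually_ge_atTop N] with j hj
  have hc : c ≤ j + 1 := hN.trans (by exact_mod_cast hj.trans j.le_succ)
  exact (hmono _ (by gcongr)).trans (hle j)

namespace YoungFunction

variable {ι : Type*} {a : ι → ℝ}

theorem bddAbove_range_abs (h : ∑' j, Ψ.scaled 1 (a j) ≠ ∞) :
    BddAbove (Set.range fun j => |a j|) := by
  lift ∑' j, Ψ.scaled 1 (a j) to ℝ≥0 using h with K hK
  obtain ⟨M, hM⟩ := (Ψ.tendsto_atTop.eventually_gt_atTop K).exists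
  refine ⟨M, Set.forall_mem_range.2 fun j => le_of_not_gt fun hlt => hM.not_ge ?_⟩
  have hMj : M ≤ ‖a j‖₊ := NNReal.coe_le_coe.1 (by simpa using hlt.le)
  have hj : Ψ.scaled 1 (a j) ≤ K := (ENNReal.le_tsum j).trans_eq hK.symm
  exact (Ψ.monotone hMj).trans (by simpa [scaled] using hj)

theorem scaled_iSup_abs_le_tsum [Nonempty ι] (ha : BddAbove (Set.range fun j => |a j|)) (c : ℝ≥0) :
    Ψ.scaled c (⨆ j, |a j|) ≤ ∑' j, Ψ.scaled c (a j) := by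
  have hmono : Monotone fun x : ℝ => Ψ.scaled c (max x 0) := fun x y hxy =>
    Ψ.scaled_le_scaled (by
      gcongr c * ?_
      rw [← NNReal.coe_le_coe, coe_nnnorm, coe_nnnorm, Real.norm_of_nonneg (le_max_right _ _),
        Real.norm_of_nonneg (le_max_right _ _)]
      exact max_le_max_right 0 hxy)
  calc Ψ.scaled c (⨆ j, |a j|)
      = Ψ.scaled c (max (⨆ j, |a j|) 0) := by
        rw [max_eq_left (Real.iSup_nonneg fun _ => abs_nonneg _)]
    _ = ⨆ j, Ψ.scaled c (max |a j| 0) :=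
        hmono.map_ciSup_of_continuousAt
          ((Ψ.continuous_scaled c).comp (continuous_id.max continuous_const)).continuousAt ha
    _ = ⨆ j, Ψ.scaled c (a j) := by simp [scaled]
    _ ≤ ∑' j, Ψ.scaled c (a j) := iSup_le ENNReal.le_tsum

end YoungFunction

theorem lintegral_scaled_lt_top (X : orliczHeart Ψ P) (c : ℝ≥0) :
    ∫⁻ ω, Ψ.scaled c ((X : Ω →ₘ[P] ℝ) ω) ∂P < ∞ := by
  rcases eq_zero_or_pos c with rfl | hc
  · simp
  · exact X.2 c hc

theorem mk_mem_orliczHeart {f : Ω → ℝ} (hf : AEStronglyMeasurable f P)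
    (h : ∀ c : ℝ≥0, ∫⁻ ω, Ψ.scaled c (f ω) ∂P < ∞) :
    AEEqFun.mk f hf ∈ orliczHeart Ψ P := fun c _ =>
  (lintegral_congr_ae ((AEEqFun.coeFn_mk f hf).fun_comp (Ψ.scaled c))).trans_lt (h c)

theorem exists_orliczHeart_ge_abs {ι : Type*} [Countable ι] [Nonempty ι] {f : ι → Ω → ℝ}
    (hf : ∀ j, Measurable (f j)) (h : ∀ c : ℝ≥0, ∫⁻ ω, ∑' j, Ψ.scaled c (f j ω) ∂P < ∞) :
    ∃ W : orliczHeart Ψ P, ∀ᵐ ω ∂P, ∀ j, |f j ω| ≤ (W : Ω →ₘ[P] ℝ) ω := by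
  have hbdd : ∀ᵐ ω ∂P, BddAbove (Set.range fun j => |f j ω|) := by
    filter_upwards [ae_lt_top (by fun_prop) (h 1).ne] with ω hω
    exact YoungFunction.bddAbove_range_abs hω.ne
  have hmeas : AEStronglyMeasurable (fun ω => ⨆ j, |f j ω|) P :=
    (Measurable.iSup fun j => (hf j).abs).aestronglyMeasurable
  refine ⟨⟨AEEqFun.mk _ hmeas, mk_mem_orliczHeart hmeas fun c =>
    (lintegral_mono_ae ?_).trans_lt (h c)⟩, ?_⟩
  · filter_upwards [hbdd] with ω hω
    exact YoungFunction.scaled_iSup_abs_le_tsum hω c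
  · filter_upwards [hbdd, AEEqFun.coeFn_mk _ hmeas] with ω hω hmk j
    exact (le_ciSup hω j).trans_eq hmk.symm

end Domination

section RiskMeasures

variable {Ω : Type*} [MeasurableSpace Ω] {P : Measure Ω} {Ψ : YoungFunction}

namespace RiskMeasure

theorem continuous_line (ρ : RiskMeasure Ψ P) (Y W : orliczHeart Ψ P) :
    Continuous fun t : ℝ => ρ.toFun (Y + t • W) := by
  have hconv : ConvexOn ℝ Set.univ fun t : ℝ => ρ.toFun (Y + t • W) := by
    refine ⟨convex_univ, fun x _ y _ a b ha hb hab => ?_⟩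
    obtain rfl : b = 1 - a := by linarith
    have hline : Y + (a • x + (1 - a) • y) • W = a • (Y + x • W) + (1 - a) • (Y + y • W) := by
      simp only [smul_eq_mul]
      module
    beta_reduce
    rw [hline]
    exact ρ.convex _ _ a ha (by linarith)
  exact continuousOn_univ.1 (hconv.continuousOn isOpen_univ)

theorem tendsto_of_abs_sub_le_mul (ρ : RiskMeasure Ψ P) {ι : Type*} {l : Filter ι}
    {X : ι → orliczHeart Ψ P} {Y W : orliczHeart Ψ P} {t : ι → ℝ} (ht : Tendsto t l (𝓝 0))
    (h : ∀ i, ∀ᵐ ω ∂P,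
      |(X i : Ω →ₘ[P] ℝ) ω - (Y : Ω →ₘ[P] ℝ) ω| ≤ t i * (W : Ω →ₘ[P] ℝ) ω) :
    Tendsto (fun i => ρ.toFun (X i)) l (𝓝 (ρ.toFun Y)) := by
  have hline (s : ℝ) : ((Y + s • W : orliczHeart Ψ P) : Ω →ₘ[P] ℝ) =ᵐ[P]
      fun ω => (Y : Ω →ₘ[P] ℝ) ω + s * (W : Ω →ₘ[P] ℝ) ω := by
    filter_upwards [AEEqFun.coeFn_add (Y : Ω →ₘ[P] ℝ) (s • (W : Ω →ₘ[P] ℝ)),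
      AEEqFun.coeFn_smul s (W : Ω →ₘ[P] ℝ)] with ω hadd hsmul
    exact hadd.trans (congrArg _ hsmul)
  have hlim {s : ι → ℝ} (hs : Tendsto s l (𝓝 0)) :
      Tendsto (fun i => ρ.toFun (Y + s i • W)) l (𝓝 (ρ.toFun Y)) := by
    simpa [Function.comp_def] using ((ρ.continuous_line Y W).tendsto 0).comp hs
  refine tendsto_of_tendsto_of_tendsto_of_le_of_le (hlim ht)
    (hlim (s := fun i => -t i) (by simpa using ht.neg)) (fun i => ?_) fun i => ?_
  · refine ρ.antitone _ _ ?_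
    filter_upwards [hline (t i), h i] with ω hω hi
    rw [hω]
    linarith [(abs_le.1 hi).2]
  · refine ρ.antitone _ _ ?_
    filter_upwards [hline (-t i), h i] with ω hω hi
    rw [hω]
    linarith [(abs_le.1 hi).1]

theorem tendsto_of_modular (ρ : RiskMeasure Ψ P) {ι : Type*} {l : Filter ι}
    [l.IsCountablyGenerated] {X : ι → orliczHeart Ψ P} {Y : orliczHeart Ψ P}
    (h : ∀ c : ℝ≥0, Tendsto (fun i => ∫⁻ ω,
      Ψ.scaled c ((X i : Ω →ₘ[P] ℝ) ω - (Y : Ω →ₘ[P] ℝ) ω) ∂P) l (𝓝 0)) :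
    Tendsto (fun i => ρ.toFun (X i)) l (𝓝 (ρ.toFun Y)) := by
  refine tendsto_of_subseq_tendsto fun i hi => ?_
  have hmeas (k : ℕ) : Measurable fun ω => (X (i k) : Ω →ₘ[P] ℝ) ω - (Y : Ω →ₘ[P] ℝ) ω :=
    (AEEqFun.measurable _).sub (AEEqFun.measurable _)
  obtain ⟨φ, -, hφ⟩ := exists_subseq_tsum_lt_top
    (F := fun c k => ∫⁻ ω, Ψ.scaled c ((X (i k) : Ω →ₘ[P] ℝ) ω - (Y : Ω →ₘ[P] ℝ) ω) ∂P)
    (fun k c c' hc => lintegral_mono fun ω => Ψ.scaled_le_scaled (by gcongr))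
    (fun c k => ((lintegral_congr_ae ((AEEqFun.coeFn_sub _ _).fun_comp (Ψ.scaled c))).symm.trans_lt
      (lintegral_scaled_lt_top (X (i k) - Y) c)).ne)
    fun c => (h c).comp hi
  obtain ⟨W, hW⟩ := exists_orliczHeart_ge_abs (Ψ := Ψ) (P := P)
    (f := fun (j : ℕ) ω => (j + 1) * ((X (i (φ j)) : Ω →ₘ[P] ℝ) ω - (Y : Ω →ₘ[P] ℝ) ω))
    (fun j => (hmeas _).const_mul _) fun c => by
      rw [lintegral_tsum fun j => (by fun_prop)]
      have hj (j : ℕ) : ‖(j + 1 : ℝ)‖₊ = j + 1 := by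
        exact_mod_cast Real.nnnorm_natCast (j + 1)
      simpa only [YoungFunction.scaled_mul, hj] using hφ c
  refine ⟨φ, ρ.tendsto_of_abs_sub_le_mul tendsto_one_div_add_atTop_nhds_zero_nat (W := W)
    fun j => ?_⟩
  filter_upwards [hW] with ω hω
  have hj : (0 : ℝ) < j + 1 := by positivity
  rw [one_div, le_inv_mul_iff₀ hj, ← abs_of_pos hj, ← abs_mul]
  exact hω j

end RiskMeasure

theorem hasFiniteMoments_of_mem_laws {μ : ProbabilityMeasure ℝ} (hμ : μ ∈ laws Ψ P) :
    Ψ.HasFiniteMoments μ := by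
  obtain ⟨X, hX⟩ := hμ
  intro c
  rw [← hX, lintegral_map (Ψ.measurable_scaled c) (AEEqFun.measurable _)]
  exact lintegral_scaled_lt_top X c

theorem exists_orliczHeart_ae_eq_quantile {U : Ω → ℝ} (hU : Measurable U) (hUP : P.map U = unif)
    {μ : ProbabilityMeasure ℝ} (hμ : Ψ.HasFiniteMoments μ) :
    ∃ X : orliczHeart Ψ P, (X : Ω →ₘ[P] ℝ) =ᵐ[P] fun ω => quantile μ (U ω) := by
  have hmeas : AEStronglyMeasurable (fun ω => quantile μ (U ω)) P :=
    ((measurable_quantile _).comp hU).aestronglyMeasurable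
  refine ⟨⟨AEEqFun.mk _ hmeas, mk_mem_orliczHeart hmeas fun c => ?_⟩, AEEqFun.coeFn_mk _ hmeas⟩
  rw [← lintegral_map (f := fun u => Ψ.scaled c (quantile μ u))
    ((Ψ.measurable_scaled c).comp (measurable_quantile _)) hU, hUP,
    lintegral_quantile _ (Ψ.measurable_scaled c)]
  exact hμ c

theorem map_eq_of_ae_eq_quantile {U : Ω → ℝ} (hU : Measurable U) (hUP : P.map U = unif)
    {μ : ProbabilityMeasure ℝ} {X : Ω → ℝ} (hX : X =ᵐ[P] fun ω => quantile μ (U ω)) :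
    P.map X = (μ : Measure ℝ) := by
  rw [Measure.map_congr hX, ← Function.comp_def, ← Measure.map_map (measurable_quantile _) hU, hUP,
    map_quantile]

theorem mem_laws_iff [IsProbabilityMeasure P] (hP : IsAtomless P) {μ : ProbabilityMeasure ℝ} :
    μ ∈ laws Ψ P ↔ Ψ.HasFiniteMoments μ := by
  refine ⟨hasFiniteMoments_of_mem_laws, fun hμ => ?_⟩
  obtain ⟨U, hU, hUP⟩ := hP.exists_uniform
  obtain ⟨X, hX⟩ := exists_orliczHeart_ae_eq_quantile hU hUP hμ
  exact ⟨X, map_eq_of_ae_eq_quantile hU hUP hX⟩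

theorem tendsto_riskFunctional [IsProbabilityMeasure P] (hP : IsAtomless P) (ρ : RiskMeasure Ψ P)
    {ι : Type*} {l : Filter ι} [l.IsCountablyGenerated] {ν : ι → laws Ψ P} {μ : laws Ψ P}
    (hlim : Tendsto ν l (𝓝 μ)) (hν : Ψ.UniformTails (fun i => ν i) l) :
    Tendsto (fun i => riskFunctional ρ (ν i)) l (𝓝 (riskFunctional ρ μ)) := by
  obtain ⟨U, hU, hUP⟩ := hP.exists_uniform
  choose X hX using fun κ : laws Ψ P =>
    exists_orliczHeart_ae_eq_quantile hU hUP (hasFiniteMoments_of_mem_laws κ.2)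
  have hρ (κ : laws Ψ P) : riskFunctional ρ κ = ρ.toFun (X κ) :=
    riskFunctional_eq ρ κ (X κ) (map_eq_of_ae_eq_quantile hU hUP (hX κ))
  simp only [hρ]
  refine ρ.tendsto_of_modular fun c => ?_
  refine (YoungFunction.tendsto_lintegral_quantile_sub (tendsto_subtype_rng.1 hlim) hν
    (hasFiniteMoments_of_mem_laws μ.2) c).congr fun i => ?_
  rw [← hUP, lintegral_map (by fun_prop) hU]
  refine lintegral_congr_ae ?_
  filter_upwards [hX (ν i), hX μ] with ω hνω hμω
  rw [hνω, hμω]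

end RiskMeasures

section LocallyUniformlyIntegrating

variable {Ψ : YoungFunction}

namespace YoungFunction

theorem UniformTails.eventually_lintegral_lt_top {ι : Type*} {ν : ι → ProbabilityMeasure ℝ}
    {l : Filter ι} (h : Ψ.UniformTails ν l) (c : ℝ≥0) :
    ∀ᶠ i in l, ∫⁻ y, Ψ.scaled c y ∂(ν i : Measure ℝ) < ∞ := by
  obtain ⟨R, hR⟩ := h c 1 zero_lt_one
  filter_upwards [hR] with i hi
  calc ∫⁻ y, Ψ.scaled c y ∂(ν i : Measure ℝ)
      ≤ ∫⁻ y, ((Ψ.scaled c y - R) + R) ∂(ν i : Measure ℝ) :=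
        lintegral_mono fun y => le_tsub_add
    _ = ∫⁻ y, (Ψ.scaled c y - R) ∂(ν i : Measure ℝ) + R := by
        rw [lintegral_add_right _ measurable_const]
        simp
    _ < ∞ := ENNReal.add_lt_top.2 ⟨hi.trans_lt ENNReal.one_lt_top, ENNReal.coe_lt_top⟩

/-- The sets of laws on which weak convergence entails convergence of all moments `∫ Ψ (c |y|)`:
near each of its points for the relative weak topology, the set has uniformly small tails. -/
def LocallyUniformlyIntegrating (Ψ : YoungFunction) (M : Set (ProbabilityMeasure ℝ)) : Prop :=
  ∀ κ : M, Ψ.UniformTails (fun ν : M => (ν : ProbabilityMeasure ℝ)) (𝓝 κ)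

variable {M : Set (ProbabilityMeasure ℝ)}

theorem LocallyUniformlyIntegrating.hasFiniteMoments (hM : Ψ.LocallyUniformlyIntegrating M)
    {κ : ProbabilityMeasure ℝ} (hκ : κ ∈ M) : Ψ.HasFiniteMoments κ := fun c =>
  ((hM ⟨κ, hκ⟩).eventually_lintegral_lt_top c).self_of_nhds

theorem LocallyUniformlyIntegrating.subset_laws (hM : Ψ.LocallyUniformlyIntegrating M)
    {Ω : Type*} [MeasurableSpace Ω] {P : Measure Ω} [IsProbabilityMeasure P] (hP : IsAtomless P) :
    M ⊆ laws Ψ P := fun _ hκ =>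
  (mem_laws_iff hP).2 (hM.hasFiniteMoments hκ)

end YoungFunction

theorem exists_le_card_add_one_mul {ι : Type*} [Fintype ι] {t b : ℝ≥0} {f : ι → ℝ≥0}
    (h : t ≤ b + ∑ i, f i) :
    t ≤ (Fintype.card ι + 1) * b ∨ ∃ i, t ≤ (Fintype.card ι + 1) * f i := by
  have hsum : ∑ _o : Option ι, t ≤ ∑ o : Option ι, (Fintype.card ι + 1) * o.elim b f := by
    rw [← Finset.mul_sum, Fintype.sum_option]
    simpa [add_comm, add_one_mul] using mul_le_mul_right h ((Fintype.card ι : ℝ≥0) + 1)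
  obtain ⟨_ | i, -, hi⟩ := Finset.exists_le_of_sum_le Finset.univ_nonempty hsum
  exacts [Or.inl hi, Or.inr ⟨i, hi⟩]

namespace YoungFunction

theorem scaled_tsub_le_sum {ι : Type*} [Fintype ι] {z : ℝ} {x : ι → ℝ} {b a : ℝ≥0}
    (h : ‖z‖₊ ≤ b + ∑ i, a * ‖x i‖₊) {c : ℝ≥0} {R : ℝ≥0∞}
    (hR : Ψ.toFun (c * ((Fintype.card ι + 1) * b)) ≤ R) :
    Ψ.scaled c z - R ≤ ∑ i, (Ψ.scaled (c * ((Fintype.card ι + 1) * a)) (x i) - R) := by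
  rcases exists_le_card_add_one_mul h with hz | ⟨i, hz⟩
  · have hle : Ψ.scaled c z ≤ R :=
      (ENNReal.coe_le_coe.2 (Ψ.monotone (mul_le_mul_right hz c))).trans hR
    simp [tsub_eq_zero_of_le hle]
  · calc Ψ.scaled c z - R
        ≤ Ψ.scaled (c * ((Fintype.card ι + 1) * a)) (x i) - R := by
          gcongr
          refine Ψ.scaled_le_scaled ((mul_le_mul_right hz c).trans_eq ?_)
          ring
      _ ≤ _ := Finset.single_le_sum
          (f := fun i => Ψ.scaled (c * ((Fintype.card ι + 1) * a)) (x i) - R)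
          (fun _ _ => zero_le) (Finset.mem_univ i)

end YoungFunction

variable {d : ℕ} {A : (Fin d → ℝ) → ℝ} {μ : Fin d → ProbabilityMeasure ℝ}

theorem lintegral_le_sum_of_mem_frechetImage (hA : Measurable A) {f : ℝ → ℝ≥0∞} (hf : Measurable f)
    {g : ℝ → ℝ≥0∞} (hg : Measurable g) (hle : ∀ x, f (A x) ≤ ∑ i, g (x i))
    {ν : ProbabilityMeasure ℝ} (hν : ν ∈ frechetImage μ A) :
    ∫⁻ y, f y ∂(ν : Measure ℝ) ≤ ∑ i, ∫⁻ y, g y ∂(μ i : Measure ℝ) := by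
  obtain ⟨m, hm, hν⟩ := hν
  calc ∫⁻ y, f y ∂(ν : Measure ℝ)
      = ∫⁻ x, f (A x) ∂(m : Measure (Fin d → ℝ)) := by rw [hν, lintegral_map hf hA]
    _ ≤ ∫⁻ x, ∑ i, g (x i) ∂(m : Measure (Fin d → ℝ)) := lintegral_mono hle
    _ = ∑ i, ∫⁻ x, g (x i) ∂(m : Measure (Fin d → ℝ)) :=
        lintegral_finsetSum _ fun i _ => hg.comp (measurable_pi_apply i)
    _ = ∑ i, ∫⁻ y, g y ∂(μ i : Measure ℝ) := Finset.sum_congr rfl fun i _ => by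
        rw [← hm i, lintegral_map hg (measurable_pi_apply i)]

theorem uniformTails_frechetImage (hA : Measurable A) {b a : ℝ}
    (hgrowth : ∀ x, |A x| ≤ b + a * ∑ i, |x i|)
    (hμ : ∀ i, Ψ.HasFiniteMoments (μ i)) :
    Ψ.UniformTails (fun ν : frechetImage μ A => (ν : ProbabilityMeasure ℝ)) ⊤ := by
  have hA_le (x : Fin d → ℝ) : ‖A x‖₊ ≤ ‖b‖₊ + ∑ i, ‖a‖₊ * ‖x i‖₊ := by
    rw [← NNReal.coe_le_coe, ← Finset.mul_sum]
    push_cast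
    refine (hgrowth x).trans ?_
    gcongr
    exacts [le_abs_self b, le_abs_self a, le_rfl]
  intro c ε hε
  set C : ℝ≥0 := c * ((Fintype.card (Fin d) + 1) * ‖a‖₊)
  have hlim : Tendsto (fun R : ℕ => ∑ i, ∫⁻ y, (Ψ.scaled C y - R) ∂(μ i : Measure ℝ))
      atTop (𝓝 0) := by
    simpa using tendsto_finsetSum Finset.univ fun i _ =>
      tendsto_lintegral_tsub_natCast (Ψ.measurable_scaled C) (hμ i C).ne
  obtain ⟨N, hN⟩ := exists_nat_ge (Ψ.toFun (c * ((Fintype.card (Fin d) + 1) * ‖b‖₊)))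
  obtain ⟨R, hRε, hNR⟩ := ((hlim.eventually_le_const hε).and (eventually_ge_atTop N)).exists
  have hR : (Ψ.toFun (c * ((Fintype.card (Fin d) + 1) * ‖b‖₊)) : ℝ≥0∞) ≤ R := by
    exact_mod_cast hN.trans (by exact_mod_cast hNR)
  refine ⟨R, Eventually.of_forall fun ν => le_trans ?_ hRε⟩
  exact lintegral_le_sum_of_mem_frechetImage hA (by fun_prop) (by fun_prop)
    (fun x => YoungFunction.scaled_tsub_le_sum (hA_le x) hR) ν.2

theorem locallyUniformlyIntegrating_frechetImage (hA : Measurable A) {b a : ℝ}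
    (hgrowth : ∀ x, |A x| ≤ b + a * ∑ i, |x i|)
    (hμ : ∀ i, Ψ.HasFiniteMoments (μ i)) :
    Ψ.LocallyUniformlyIntegrating (frechetImage μ A) := fun _ =>
  (uniformTails_frechetImage hA hgrowth hμ).comp (g := id) tendsto_top

end LocallyUniformlyIntegrating

section EmpiricalMeasures

variable {E : Type*} [MeasurableSpace E]

theorem lintegral_empiricalMeasure {f : E → ℝ≥0∞} (hf : Measurable f) (n : ℕ+) (x : ℕ → E) :
    ∫⁻ a, f a ∂(empiricalMeasure n x : Measure E) =
      ((n : ℕ) : ℝ≥0∞)⁻¹ * ∑ i ∈ Finset.range n, f (x i) := by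
  simp only [empiricalMeasure, ProbabilityMeasure.coe_mk, lintegral_smul_measure,
    lintegral_finsetSum_measure, lintegral_dirac' _ hf, smul_eq_mul]

theorem map_empiricalMeasure {F : Type*} [MeasurableSpace F] {f : E → F} (hf : Measurable f)
    (n : ℕ+) (x : ℕ → E) :
    (empiricalMeasure n x).map hf.aemeasurable = empiricalMeasure n (f ∘ x) := by
  refine Subtype.ext (Measure.ext fun s hs => ?_)
  have hind : Measurable (s.indicator (1 : F → ℝ≥0∞)) := measurable_one.indicator hs
  calc (empiricalMeasure n x : Measure E).map f s
      = ∫⁻ b, s.indicator 1 b ∂(empiricalMeasure n x : Measure E).map f :=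
        (lintegral_indicator_one hs).symm
    _ = ∫⁻ a, s.indicator 1 (f a) ∂(empiricalMeasure n x : Measure E) := lintegral_map hind hf
    _ = ((n : ℕ) : ℝ≥0∞)⁻¹ * ∑ i ∈ Finset.range n, s.indicator 1 (f (x i)) :=
        lintegral_empiricalMeasure (hind.comp hf) n x
    _ = ∫⁻ b, s.indicator 1 b ∂(empiricalMeasure n (f ∘ x) : Measure F) :=
        (lintegral_empiricalMeasure hind n (f ∘ x)).symm
    _ = (empiricalMeasure n (f ∘ x) : Measure F) s := lintegral_indicator_one hs

theorem tendsto_lintegral_empiricalMeasure_of_tendsto_average {f : E → ℝ≥0∞} (hf : Measurable f)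
    {x : ℕ → E} (hx : ∀ i, f (x i) ≠ ∞) {L : ℝ≥0∞} (hL : L ≠ ∞)
    (h : Tendsto (fun n : ℕ => (∑ i ∈ Finset.range n, (f (x i)).toReal) / n) atTop
      (𝓝 L.toReal)) :
    Tendsto (fun n : ℕ+ => ∫⁻ a, f a ∂(empiricalMeasure n x : Measure E)) atTop (𝓝 L) := by
  have hcast : Tendsto (fun n : ℕ+ => (n : ℕ)) atTop atTop := tendsto_PNat_val_atTop_atTop
  rw [← ENNReal.ofReal_toReal hL]
  refine (ENNReal.tendsto_ofReal (h.comp hcast)).congr fun n => ?_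
  rw [lintegral_empiricalMeasure hf, Function.comp_apply, div_eq_inv_mul,
    ENNReal.ofReal_mul (by positivity), ENNReal.ofReal_inv_of_pos (by positivity),
    ENNReal.ofReal_natCast, ENNReal.ofReal_sum_of_nonneg fun i _ => ENNReal.toReal_nonneg]
  simp only [ENNReal.ofReal_toReal (hx _)]

theorem ae_tendsto_lintegral_empiricalMeasure (μ : ProbabilityMeasure E) {f : E → ℝ≥0∞}
    (hf : Measurable f) (hfin : ∫⁻ a, f a ∂(μ : Measure E) ≠ ∞) :
    ∀ᵐ x ∂Measure.infinitePi fun _ : ℕ => (μ : Measure E),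
      Tendsto (fun n : ℕ+ => ∫⁻ a, f a ∂(empiricalMeasure n x : Measure E)) atTop
        (𝓝 (∫⁻ a, f a ∂(μ : Measure E))) := by
  have heval (i : ℕ) : MeasurePreserving (Function.eval i)
      (Measure.infinitePi fun _ : ℕ => (μ : Measure E)) (μ : Measure E) :=
    measurePreserving_eval_infinitePi _ i
  have hg : Measurable fun a => (f a).toReal := hf.ennreal_toReal
  have hident (i : ℕ) : ProbabilityTheory.IdentDistrib (fun x : ℕ → E => (f (x i)).toReal)
      (fun a => (f a).toReal) (Measure.infinitePi fun _ : ℕ => (μ : Measure E)) μ :=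
    ⟨(hg.comp (measurable_pi_apply i)).aemeasurable, hg.aemeasurable, by
      conv_rhs => rw [← (heval i).map_eq, Measure.map_map hg (heval i).measurable]
      rfl⟩
  have hslln := ProbabilityTheory.strong_law_ae_real
    (μ := Measure.infinitePi fun _ : ℕ => (μ : Measure E)) (fun i x => (f (x i)).toReal)
    ((hident 0).integrable_iff.2 (integrable_toReal_of_lintegral_ne_top hf.aemeasurable hfin))
    (fun i j hij => (ProbabilityTheory.iIndepFun_infinitePi (P := fun _ : ℕ => (μ : Measure E))
      (X := fun _ a => (f a).toReal) fun _ => hg).indepFun hij)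
    fun i => (hident i).trans (hident 0).symm
  rw [(hident 0).integral_eq, integral_toReal hf.aemeasurable (ae_lt_top hf hfin)] at hslln
  have hae : ∀ᵐ x ∂Measure.infinitePi fun _ : ℕ => (μ : Measure E), ∀ i, f (x i) ≠ ∞ :=
    ae_all_iff.2 fun i => (heval i).quasiMeasurePreserving.ae
      ((ae_lt_top hf hfin).mono fun _ h => h.ne)
  filter_upwards [hslln, hae] with x hx hx'
  exact tendsto_lintegral_empiricalMeasure_of_tendsto_average hf hx' hfin hx

theorem ae_tendsto_empiricalMeasure [TopologicalSpace E] [SecondCountableTopology E]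
    [OpensMeasurableSpace E] (μ : ProbabilityMeasure E) :
    ∀ᵐ x ∂Measure.infinitePi fun _ : ℕ => (μ : Measure E),
      Tendsto (fun n : ℕ+ => empiricalMeasure n x) atTop (𝓝 μ) := by
  obtain ⟨B, hBc, -, hB⟩ := TopologicalSpace.exists_countable_basis E
  let S : Set (Set E) := Set.sInter '' {t | t.Finite ∧ t ⊆ B}
  have hopen : ∀ s ∈ S, IsOpen s := by
    rintro _ ⟨t, ⟨ht, htB⟩, rfl⟩
    exact ht.isOpen_sInter fun b hb => hB.isOpen (htB hb)
  have hpi : IsPiSystem S := by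
    rintro _ ⟨t, ⟨ht, htB⟩, rfl⟩ _ ⟨t', ⟨ht', htB'⟩, rfl⟩ -
    exact ⟨t ∪ t', ⟨ht.union ht', Set.union_subset htB htB'⟩, Set.sInter_union t t'⟩
  have hae : ∀ᵐ x ∂Measure.infinitePi fun _ : ℕ => (μ : Measure E), ∀ s ∈ S, Tendsto
      (fun n : ℕ+ => (empiricalMeasure n x : Measure E) s) atTop (𝓝 ((μ : Measure E) s)) := by
    refine (ae_ball_iff ((Set.countable_ofPred_finite_subset hBc).image _)).2 fun s hs => ?_
    have hs' := (hopen s hs).measurableSet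
    simpa only [lintegral_indicator_one hs'] using ae_tendsto_lintegral_empiricalMeasure μ
      (measurable_one.indicator hs') (by simp [lintegral_indicator_one hs'])
  filter_upwards [hae] with x hx
  refine hpi.tendsto_probabilityMeasure_of_tendsto_of_mem (fun s hs => (hopen s hs).measurableSet)
    (fun u hu a ha => ?_) fun s hs => (ENNReal.tendsto_toNNReal (measure_ne_top _ _)).comp (hx s hs)
  obtain ⟨b, hb, hab, hbu⟩ := hB.exists_subset_of_mem_open ha hu
  exact ⟨b, ⟨{b}, ⟨Set.finite_singleton b, Set.singleton_subset_iff.2 hb⟩, Set.sInter_singleton b⟩,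
    (hB.isOpen hb).mem_nhds hab, hbu⟩

variable {Ψ : YoungFunction}

theorem ae_uniformTails_empiricalMeasure {μ : ProbabilityMeasure ℝ} (hμ : Ψ.HasFiniteMoments μ) :
    ∀ᵐ x ∂Measure.infinitePi fun _ : ℕ => (μ : Measure ℝ),
      Ψ.UniformTails (fun n : ℕ+ => empiricalMeasure n x) atTop := by
  have hae : ∀ᵐ x ∂Measure.infinitePi fun _ : ℕ => (μ : Measure ℝ), ∀ c R : ℕ,
      Tendsto (fun n : ℕ+ => ∫⁻ y, (Ψ.scaled c y - R) ∂(empiricalMeasure n x : Measure ℝ)) atTop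
        (𝓝 (∫⁻ y, (Ψ.scaled c y - R) ∂(μ : Measure ℝ))) :=
    ae_all_iff.2 fun c => ae_all_iff.2 fun R => ae_tendsto_lintegral_empiricalMeasure μ
      ((Ψ.measurable_scaled c).sub_const _)
      ((lintegral_mono fun _ => tsub_le_self).trans_lt (hμ c)).ne
  filter_upwards [hae] with x hx c ε hε
  obtain ⟨N, hN⟩ := exists_nat_ge c
  obtain ⟨R, hR⟩ := ((tendsto_lintegral_tsub_natCast (Ψ.measurable_scaled N)
    (hμ N).ne).eventually_lt_const hε).exists
  refine ⟨R, ?_⟩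
  filter_upwards [(hx N R).eventually_le_const hR] with n hn
  refine (lintegral_mono fun y => ?_).trans hn
  exact tsub_le_tsub (Ψ.scaled_le_scaled (by gcongr)) (by simp)

theorem hasFiniteMoments_empiricalMeasure (n : ℕ+) (x : ℕ → ℝ) :
    Ψ.HasFiniteMoments (empiricalMeasure n x : Measure ℝ) := fun c => by
  rw [lintegral_empiricalMeasure (Ψ.measurable_scaled c)]
  exact ENNReal.mul_lt_top (by simp) (ENNReal.sum_lt_top.2 fun i _ =>
    (Ψ.scaled_ne_top c (x i)).lt_top)

theorem empiricalMeasures_subset_laws {Ω : Type*} [MeasurableSpace Ω] {P : Measure Ω}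
    [IsProbabilityMeasure P] (hP : IsAtomless P) : empiricalMeasures ℝ ⊆ laws Ψ P := by
  rintro _ ⟨n, x, rfl⟩
  exact (mem_laws_iff hP).2 (hasFiniteMoments_empiricalMeasure n x)

end EmpiricalMeasures

section Couplings

theorem levyProkhorovDist_map_le {α E : Type*} [MeasurableSpace α] [PseudoMetricSpace E]
    [MeasurableSpace E] [OpensMeasurableSpace E] {Q : Measure α} [IsProbabilityMeasure Q]
    {f g : α → E} (hf : Measurable f) (hg : Measurable g) {ε : ℝ} (hε : 0 ≤ ε)
    (h : Q {a | ε ≤ dist (f a) (g a)} ≤ ENNReal.ofReal ε) :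
    levyProkhorovDist (Q.map f) (Q.map g) ≤ ε := by
  have := Measure.isProbabilityMeasure_map (μ := Q) hf.aemeasurable
  have := Measure.isProbabilityMeasure_map (μ := Q) hg.aemeasurable
  refine levyProkhorovDist_le_of_forall_le _ _ hε fun δ B hδ hB => ?_
  rw [Measure.map_apply hf hB, Measure.map_apply hg Metric.isOpen_thickening.measurableSet]
  calc Q (f ⁻¹' B) ≤ Q (g ⁻¹' Metric.thickening δ B ∪ {a | ε ≤ dist (f a) (g a)}) := by
        refine measure_mono fun a ha => or_iff_not_imp_right.2 fun hlt => ?_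
        exact Metric.mem_thickening_iff.2
          ⟨f a, ha, by rw [dist_comm]; exact (not_le.1 hlt).trans hδ⟩
    _ ≤ Q (g ⁻¹' Metric.thickening δ B) + Q {a | ε ≤ dist (f a) (g a)} := measure_union_le _ _
    _ ≤ Q (g ⁻¹' Metric.thickening δ B) + ENNReal.ofReal δ := by
        gcongr
        exact h.trans (ENNReal.ofReal_le_ofReal hδ.le)

namespace YoungFunction

variable {Ψ : YoungFunction}

variable (Ψ) in
theorem exists_one_le_scaled {δ : ℝ} (hδ : 0 < δ) :
    ∃ c : ℝ≥0, ∀ z : ℝ, δ ≤ |z| → 1 ≤ Ψ.scaled c z := by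
  obtain ⟨t, ht⟩ := (Ψ.tendsto_atTop.eventually_ge_atTop 1).exists
  lift δ to ℝ≥0 using hδ.le
  refine ⟨t / δ, fun z hz => ?_⟩
  have hδz : δ ≤ ‖z‖₊ := hz
  have hle : t ≤ t / δ * ‖z‖₊ := by
    calc t = t / δ * δ := (div_mul_cancel₀ t (by exact_mod_cast hδ.ne')).symm
      _ ≤ t / δ * ‖z‖₊ := by gcongr
  exact ENNReal.one_le_coe_iff.2 (ht.trans (Ψ.monotone hle))

variable {ι : Type*} {l : Filter ι} {m : ι → ProbabilityMeasure (ℝ × ℝ)}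

theorem UniformTails.fst_of_snd
    (hsnd : Ψ.UniformTails (fun i => (m i).map measurable_snd.aemeasurable) l)
    (hgap : ∀ c, Tendsto (fun i => ∫⁻ p, Ψ.scaled c (p.1 - p.2) ∂(m i : Measure (ℝ × ℝ))) l
      (𝓝 0)) :
    Ψ.UniformTails (fun i => (m i).map measurable_fst.aemeasurable) l := by
  intro c ε hε
  have hε' := ENNReal.half_pos hε.ne'
  obtain ⟨R, hR⟩ := hsnd (2 * c) _ hε'
  have hmeas (c : ℝ≥0) : Measurable fun y => Ψ.scaled c y - (R : ℝ≥0∞) :=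
    (Ψ.measurable_scaled c).sub_const _
  refine ⟨R, ?_⟩
  filter_upwards [hR, (hgap (2 * c)).eventually_le_const hε'] with i htail hgap
  rw [ProbabilityMeasure.toMeasure_map, lintegral_map (hmeas _) measurable_snd] at htail
  rw [ProbabilityMeasure.toMeasure_map, lintegral_map (hmeas _) measurable_fst]
  calc ∫⁻ p, (Ψ.scaled c p.1 - R) ∂(m i : Measure (ℝ × ℝ))
      ≤ ∫⁻ p, (Ψ.scaled (2 * c) (p.1 - p.2) + (Ψ.scaled (2 * c) p.2 - R))
          ∂(m i : Measure (ℝ × ℝ)) := by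
        refine lintegral_mono fun p => ?_
        have h := Ψ.scaled_add_tsub_le c (p.1 - p.2) p.2 R
        rw [sub_add_cancel] at h
        exact h.trans (add_le_add_left tsub_le_self _)
    _ = ∫⁻ p, Ψ.scaled (2 * c) (p.1 - p.2) ∂(m i : Measure (ℝ × ℝ)) +
          ∫⁻ p, (Ψ.scaled (2 * c) p.2 - R) ∂(m i : Measure (ℝ × ℝ)) :=
        lintegral_add_left (by fun_prop) _
    _ ≤ ε := (add_le_add hgap htail).trans_eq (ENNReal.add_halves ε)

theorem tendsto_levyProkhorovDist_of_tendsto_lintegral_scaled_sub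
    (hgap : ∀ c, Tendsto (fun i => ∫⁻ p, Ψ.scaled c (p.1 - p.2) ∂(m i : Measure (ℝ × ℝ))) l
      (𝓝 0)) :
    Tendsto (fun i => levyProkhorovDist ((m i : Measure (ℝ × ℝ)).map Prod.snd)
      ((m i : Measure (ℝ × ℝ)).map Prod.fst)) l (𝓝 0) := by
  refine (Metric.nhds_basis_closedBall.tendsto_right_iff).2 fun ε hε => ?_
  obtain ⟨c, hc⟩ := Ψ.exists_one_le_scaled hε
  filter_upwards [(hgap c).eventually_le_const (ENNReal.ofReal_pos.2 hε)] with i hi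
  rw [Metric.mem_closedBall, dist_zero_right, Real.norm_eq_abs, levyProkhorovDist,
    ENNReal.abs_toReal]
  refine levyProkhorovDist_map_le measurable_snd measurable_fst hε.le ?_
  calc (m i : Measure (ℝ × ℝ)) {p | ε ≤ dist p.2 p.1}
      ≤ (m i : Measure (ℝ × ℝ)) {p | 1 ≤ Ψ.scaled c (p.1 - p.2)} :=
        measure_mono fun p hp => hc _ (by rwa [← Real.dist_eq, dist_comm])
    _ ≤ ∫⁻ p, Ψ.scaled c (p.1 - p.2) ∂(m i : Measure (ℝ × ℝ)) := by
        simpa using mul_meas_ge_le_lintegral (μ := (m i : Measure (ℝ × ℝ)))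
          (f := fun p => Ψ.scaled c (p.1 - p.2)) (by fun_prop) 1
    _ ≤ ENNReal.ofReal ε := hi

theorem tendsto_fst_of_tendsto_snd {μ : ProbabilityMeasure ℝ}
    (hsnd : Tendsto (fun i => (m i).map measurable_snd.aemeasurable) l (𝓝 μ))
    (hgap : ∀ c, Tendsto (fun i => ∫⁻ p, Ψ.scaled c (p.1 - p.2) ∂(m i : Measure (ℝ × ℝ))) l
      (𝓝 0)) :
    Tendsto (fun i => (m i).map measurable_fst.aemeasurable) l (𝓝 μ) := by
  let e := LevyProkhorov.probabilityMeasureHomeomorph (Ω := ℝ)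
  refine e.isInducing.tendsto_nhds_iff.2 ?_
  exact ((e.continuous.tendsto μ).comp hsnd).congr_dist
    (tendsto_levyProkhorovDist_of_tendsto_lintegral_scaled_sub hgap)

end YoungFunction

end Couplings

section PlugIn

/-- The mean modular `n⁻¹ ∑_{i<n} Ψ (c |x i - y i|)` of the difference of two samples. -/
def YoungFunction.meanGap (Ψ : YoungFunction) (c : ℝ≥0) (n : ℕ+) (x y : ℕ → ℝ) : ℝ≥0∞ :=
  ((n : ℕ) : ℝ≥0∞)⁻¹ * ∑ i ∈ Finset.range n, Ψ.scaled c (x i - y i)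

variable {Ψ : YoungFunction} {Ω : Type*} [MeasurableSpace Ω] {P : Measure Ω}
  [IsProbabilityMeasure P] {ι : Type*} {l : Filter ι} {n : ι → ℕ+} {x y : ι → ℕ → ℝ}

theorem lintegral_empiricalMeasure_prodMk (c : ℝ≥0) (n : ℕ+) (x y : ℕ → ℝ) :
    ∫⁻ p, Ψ.scaled c (p.1 - p.2)
      ∂(empiricalMeasure n (fun i => (x i, y i)) : Measure (ℝ × ℝ)) = Ψ.meanGap c n x y :=
  lintegral_empiricalMeasure (by fun_prop) n _

theorem map_fst_empiricalMeasure_prodMk (n : ℕ+) (x y : ℕ → ℝ) :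
    (empiricalMeasure n fun i => (x i, y i)).map measurable_fst.aemeasurable =
      empiricalMeasure n x :=
  map_empiricalMeasure measurable_fst n _

theorem map_snd_empiricalMeasure_prodMk (n : ℕ+) (x y : ℕ → ℝ) :
    (empiricalMeasure n fun i => (x i, y i)).map measurable_snd.aemeasurable =
      empiricalMeasure n y :=
  map_empiricalMeasure measurable_snd n _

theorem tendsto_empiricalMeasure_of_meanGap {μ : ProbabilityMeasure ℝ}
    (hy : Tendsto (fun i => empiricalMeasure (n i) (y i)) l (𝓝 μ))
    (hgap : ∀ c, Tendsto (fun i => Ψ.meanGap c (n i) (x i) (y i)) l (𝓝 0)) :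
    Tendsto (fun i => empiricalMeasure (n i) (x i)) l (𝓝 μ) := by
  have h := YoungFunction.tendsto_fst_of_tendsto_snd (Ψ := Ψ) (l := l) (μ := μ)
    (m := fun i => empiricalMeasure (n i) fun j => (x i j, y i j))
  simp only [map_fst_empiricalMeasure_prodMk, map_snd_empiricalMeasure_prodMk,
    lintegral_empiricalMeasure_prodMk] at h
  exact h hy hgap

theorem uniformTails_empiricalMeasure_of_meanGap
    (hy : Ψ.UniformTails (fun i => empiricalMeasure (n i) (y i)) l)
    (hgap : ∀ c, Tendsto (fun i => Ψ.meanGap c (n i) (x i) (y i)) l (𝓝 0)) :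
    Ψ.UniformTails (fun i => empiricalMeasure (n i) (x i)) l := by
  have h := YoungFunction.UniformTails.fst_of_snd (Ψ := Ψ) (l := l)
    (m := fun i => empiricalMeasure (n i) fun j => (x i j, y i j))
  simp only [map_fst_empiricalMeasure_prodMk, map_snd_empiricalMeasure_prodMk,
    lintegral_empiricalMeasure_prodMk] at h
  exact h hy hgap

variable [l.IsCountablyGenerated]

theorem tendsto_plugIn (hP : IsAtomless P) (ρ : RiskMeasure Ψ P)
    (hE : empiricalMeasures ℝ ⊆ laws Ψ P) {μ : laws Ψ P}
    (hx : Tendsto (fun i => empiricalMeasure (n i) (x i)) l (𝓝 (μ : ProbabilityMeasure ℝ)))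
    (htail : Ψ.UniformTails (fun i => empiricalMeasure (n i) (x i)) l) :
    Tendsto (fun i => plugIn hE (riskFunctional ρ) (n i) (x i)) l (𝓝 (riskFunctional ρ μ)) :=
  tendsto_riskFunctional hP ρ
    (ν := fun i => ⟨empiricalMeasure (n i) (x i), hE ⟨n i, x i, rfl⟩⟩)
    (tendsto_subtype_rng.2 hx) htail

theorem tendsto_plugIn_sub (hP : IsAtomless P) (ρ : RiskMeasure Ψ P)
    (hE : empiricalMeasures ℝ ⊆ laws Ψ P) {μ : laws Ψ P}
    (hy : Tendsto (fun i => empiricalMeasure (n i) (y i)) l (𝓝 (μ : ProbabilityMeasure ℝ)))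
    (htail : Ψ.UniformTails (fun i => empiricalMeasure (n i) (y i)) l)
    (hgap : ∀ c, Tendsto (fun i => Ψ.meanGap c (n i) (x i) (y i)) l (𝓝 0)) :
    Tendsto (fun i => plugIn hE (riskFunctional ρ) (n i) (x i) -
      plugIn hE (riskFunctional ρ) (n i) (y i)) l (𝓝 0) := by
  simpa using (tendsto_plugIn hP ρ hE (tendsto_empiricalMeasure_of_meanGap hy hgap)
    (uniformTails_empiricalMeasure_of_meanGap htail hgap)).sub (tendsto_plugIn hP ρ hE hy htail)

theorem tendsto_plugIn_sub_const (hP : IsAtomless P) (ρ : RiskMeasure Ψ P)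
    (hE : empiricalMeasures ℝ ⊆ laws Ψ P) (n : ℕ+) (y : ℕ → ℝ)
    (hgap : ∀ c, Tendsto (fun i => Ψ.meanGap c n (x i) y) l (𝓝 0)) :
    Tendsto (fun i => plugIn hE (riskFunctional ρ) n (x i) - plugIn hE (riskFunctional ρ) n y) l
      (𝓝 0) :=
  tendsto_plugIn_sub hP ρ hE (n := fun _ => n) (y := fun _ => y)
    (μ := ⟨empiricalMeasure n y, hE ⟨n, y, rfl⟩⟩) tendsto_const_nhds
    ((hasFiniteMoments_empiricalMeasure n y).uniformTails_const l) hgap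

theorem continuous_plugIn (hP : IsAtomless P) (ρ : RiskMeasure Ψ P)
    (hE : empiricalMeasures ℝ ⊆ laws Ψ P) (n : ℕ+) :
    Continuous (plugIn hE (riskFunctional ρ) n) := by
  refine continuous_iff_continuousAt.2 fun y => tendsto_sub_nhds_zero_iff.1 ?_
  refine tendsto_plugIn_sub_const hP ρ hE n y fun c => ?_
  have hsum : Continuous fun x : ℕ → ℝ => ∑ i ∈ Finset.range n, Ψ.scaled c (x i - y i) :=
    continuous_finsetSum _ fun i _ =>
      (Ψ.continuous_scaled c).comp ((continuous_apply i).sub continuous_const)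
  have h := ENNReal.Tendsto.const_mul (a := ((n : ℕ) : ℝ≥0∞)⁻¹) (hsum.tendsto y)
    (Or.inr (by simp))
  simpa [YoungFunction.meanGap] using h

end PlugIn

section Robustness

/-- The law of a sequence of independent uniform random variables. Transforming it by quantile
functions couples the samples of all distributions at once. -/
def unifSeq : Measure (ℕ → ℝ) := Measure.infinitePi fun _ => unif

instance : IsProbabilityMeasure unifSeq := inferInstanceAs
  (IsProbabilityMeasure (Measure.infinitePi fun _ : ℕ => unif))

/-- The sequence of independent observations with law `μ` obtained from uniform ones. -/
def sample (μ : ProbabilityMeasure ℝ) (u : ℕ → ℝ) (i : ℕ) : ℝ := quantile μ (u i)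

@[fun_prop]
theorem measurable_sample (μ : ProbabilityMeasure ℝ) : Measurable (sample μ) :=
  measurable_pi_lambda _ fun i => (measurable_quantile _).comp (measurable_pi_apply i)

theorem measurePreserving_sample (μ : ProbabilityMeasure ℝ) :
    MeasurePreserving (sample μ) unifSeq (Measure.infinitePi fun _ => (μ : Measure ℝ)) where
  measurable := measurable_sample μ
  map_eq := by
    simpa only [map_quantile] using! Measure.infinitePi_map_pi (fun _ : ℕ => unif)
      (f := fun _ => quantile (μ : Measure ℝ)) fun _ => measurable_quantile _

theorem estimatorLaw_eq_map_sample {S : Type*} [MeasurableSpace S] (μ : ProbabilityMeasure ℝ)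
    {t : (ℕ → ℝ) → S} (ht : Measurable t) :
    estimatorLaw μ t = unifSeq.map fun u => t (sample μ u) := by
  rw [estimatorLaw, ← (measurePreserving_sample μ).map_eq, Measure.map_map ht (measurable_sample μ)]
  rfl

theorem exists_subseq_ae_tendsto_zero {α : Type*} [MeasurableSpace α] {μ : Measure α}
    {f : ℝ≥0 → ℕ → α → ℝ≥0∞} (hf : ∀ c k, Measurable (f c k))
    (hmono : ∀ k a, Monotone fun c => f c k a)
    (hlim : ∀ c, Tendsto (fun k => ∫⁻ a, f c k a ∂μ) atTop (𝓝 0)) :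
    ∃ φ : ℕ → ℕ, StrictMono φ ∧ ∀ᵐ a ∂μ, ∀ c, Tendsto (fun j => f c (φ j) a) atTop (𝓝 0) := by
  obtain ⟨φ, hφ, hle⟩ := extraction_forall_of_eventually fun j : ℕ =>
    (hlim j).eventually_le_const (ENNReal.pow_pos (by simp : (0 : ℝ≥0∞) < 2⁻¹) j)
  refine ⟨φ, hφ, ?_⟩
  have hsum : ∫⁻ a, ∑' j : ℕ, f j (φ j) a ∂μ ≠ ∞ := by
    rw [lintegral_tsum fun j : ℕ => (hf j (φ j)).aemeasurable]
    refine ne_top_of_le_ne_top ?_ (ENNReal.tsum_le_tsum hle)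
    rw [ENNReal.tsum_geometric_two]
    exact ENNReal.ofNat_ne_top
  filter_upwards [ae_lt_top (Measurable.tsum fun j : ℕ => hf j (φ j)) hsum] with a ha c
  refine tendsto_of_tendsto_of_tendsto_of_le_of_le' tendsto_const_nhds
    (ENNReal.tendsto_atTop_zero_of_tsum_ne_top ha.ne) (.of_forall fun _ => zero_le) ?_
  obtain ⟨N, hN⟩ := exists_nat_ge c
  filter_upwards [eventually_ge_atTop N] with j hj
  exact hmono _ _ (hN.trans (by exact_mod_cast hj))

variable {Ψ : YoungFunction}

@[fun_prop]
theorem measurable_meanGap_sample (c : ℝ≥0) (n : ℕ+) (ν μ : ProbabilityMeasure ℝ) :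
    Measurable fun u => Ψ.meanGap c n (sample ν u) (sample μ u) := by
  unfold YoungFunction.meanGap
  fun_prop

theorem lintegral_meanGap_sample (c : ℝ≥0) (n : ℕ+) (ν μ : ProbabilityMeasure ℝ) :
    ∫⁻ u, Ψ.meanGap c n (sample ν u) (sample μ u) ∂unifSeq =
      ∫⁻ v, Ψ.scaled c (quantile ν v - quantile μ v) ∂unif := by
  have hmeas : Measurable fun v => Ψ.scaled c (quantile ν v - quantile μ v) := by fun_prop
  have heval (i : ℕ) : ∫⁻ u, Ψ.scaled c (sample ν u i - sample μ u i) ∂unifSeq =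
      ∫⁻ v, Ψ.scaled c (quantile ν v - quantile μ v) ∂unif :=
    (measurePreserving_eval_infinitePi (fun _ : ℕ => unif) i).lintegral_comp hmeas
  simp only [YoungFunction.meanGap]
  rw [lintegral_const_mul' _ _ (by simp), lintegral_finsetSum _ fun i _ => by fun_prop]
  simp only [heval, Finset.sum_const, Finset.card_range, nsmul_eq_mul]
  exact ENNReal.inv_mul_cancel_left (by simp) (ENNReal.natCast_ne_top _)

theorem exists_subseq_meanGap_sample {ν : ℕ → ProbabilityMeasure ℝ} {μ : ProbabilityMeasure ℝ}
    (hlim : Tendsto ν atTop (𝓝 μ)) (hν : Ψ.UniformTails ν atTop) (hμ : Ψ.HasFiniteMoments μ)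
    (n : ℕ → ℕ+) :
    ∃ φ : ℕ → ℕ, StrictMono φ ∧ ∀ᵐ u ∂unifSeq, ∀ c, Tendsto (fun j =>
      Ψ.meanGap c (n (φ j)) (sample (ν (φ j)) u) (sample μ u)) atTop (𝓝 0) := by
  refine exists_subseq_ae_tendsto_zero (fun c k => measurable_meanGap_sample c (n k) (ν k) μ)
    (fun k u c c' hc => ?_) fun c => ?_
  · exact mul_le_mul_right (Finset.sum_le_sum fun i _ => Ψ.scaled_le_scaled (by gcongr)) _
  · simpa only [lintegral_meanGap_sample] using
      YoungFunction.tendsto_lintegral_quantile_sub hlim hν hμ c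

theorem exists_subseq_const_or_tendsto_atTop {α : Type*} [LinearOrder α] [LocallyFiniteOrderBot α]
    (n : ℕ → α) :
    ∃ φ : ℕ → ℕ, StrictMono φ ∧ ((∃ m, ∀ k, n (φ k) = m) ∨ Tendsto (n ∘ φ) atTop atTop) := by
  by_cases h : ∃ m, ∃ᶠ k in atTop, n k = m
  · obtain ⟨m, hm⟩ := h
    obtain ⟨φ, hφ, hφm⟩ := extraction_of_frequently_atTop hm
    exact ⟨φ, hφ, Or.inl ⟨m, hφm⟩⟩
  · push Not at h
    refine ⟨id, strictMono_id, Or.inr (tendsto_atTop.2 fun b => ?_)⟩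
    filter_upwards [(eventually_all_finite (Set.finite_Iio b)).2 fun m _ => h m] with k hk
    exact not_lt.1 fun hlt => hk _ hlt rfl

theorem tendsto_levyProkhorovDist_map_of_ae {α E : Type*} [MeasurableSpace α]
    [PseudoMetricSpace E] [SecondCountableTopology E] [MeasurableSpace E] [OpensMeasurableSpace E]
    {Q : Measure α} [IsProbabilityMeasure Q] {f g : ℕ → α → E} (hf : ∀ j, Measurable (f j))
    (hg : ∀ j, Measurable (g j))
    (hfg : ∀ᵐ a ∂Q, Tendsto (fun j => dist (f j a) (g j a)) atTop (𝓝 0)) :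
    Tendsto (fun j => levyProkhorovDist (Q.map (f j)) (Q.map (g j))) atTop (𝓝 0) := by
  have hmeas : TendstoInMeasure Q (fun j a => dist (f j a) (g j a)) atTop fun _ => 0 :=
    tendstoInMeasure_of_tendsto_ae
      (fun j => ((hf j).dist (hg j)).aestronglyMeasurable) hfg
  refine Metric.nhds_basis_closedBall.tendsto_right_iff.2 fun ε hε => ?_
  have hε' := ENNReal.ofReal_pos.2 hε
  filter_upwards [(tendstoInMeasure_iff_norm.1 hmeas ε hε).eventually_le_const hε'] with j hj
  rw [Metric.mem_closedBall, dist_zero_right, Real.norm_eq_abs, levyProkhorovDist,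
    ENNReal.abs_toReal]
  exact levyProkhorovDist_map_le (hf j) (hg j) hε.le (by simpa using hj)

variable {Ω : Type*} [MeasurableSpace Ω] {P : Measure Ω} [IsProbabilityMeasure P]

theorem ae_tendsto_plugIn_sample_sub (hP : IsAtomless P) (ρ : RiskMeasure Ψ P)
    (hE : empiricalMeasures ℝ ⊆ laws Ψ P) {ν : ℕ → ProbabilityMeasure ℝ}
    {μ : ProbabilityMeasure ℝ} (hμ : Ψ.HasFiniteMoments μ) {n : ℕ → ℕ+}
    (hn : (∃ m, ∀ k, n k = m) ∨ Tendsto n atTop atTop)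
    (hgap : ∀ᵐ u ∂unifSeq, ∀ c, Tendsto (fun k =>
      Ψ.meanGap c (n k) (sample (ν k) u) (sample μ u)) atTop (𝓝 0)) :
    ∀ᵐ u ∂unifSeq, Tendsto (fun k => plugIn hE (riskFunctional ρ) (n k) (sample (ν k) u) -
      plugIn hE (riskFunctional ρ) (n k) (sample μ u)) atTop (𝓝 0) := by
  rcases hn with ⟨m, hm⟩ | hn
  · filter_upwards [hgap] with u hu
    simp only [hm] at hu ⊢
    exact tendsto_plugIn_sub_const hP ρ hE m _ hu
  · have hsample := (measurePreserving_sample μ).quasiMeasurePreserving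
    filter_upwards [hgap, hsample.ae (ae_tendsto_empiricalMeasure μ),
      hsample.ae (ae_uniformTails_empiricalMeasure hμ)] with u hu hlim htail
    exact tendsto_plugIn_sub hP ρ hE (μ := ⟨μ, (mem_laws_iff hP).2 hμ⟩)
      (hlim.comp hn) (htail.comp hn) hu

theorem tendsto_levyProkhorovDist_estimatorLaw (hP : IsAtomless P) (ρ : RiskMeasure Ψ P)
    (hE : empiricalMeasures ℝ ⊆ laws Ψ P) {ν : ℕ → ProbabilityMeasure ℝ}
    {μ : ProbabilityMeasure ℝ} (hμ : Ψ.HasFiniteMoments μ) (hlim : Tendsto ν atTop (𝓝 μ))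
    (hν : Ψ.UniformTails ν atTop) (n : ℕ → ℕ+) :
    Tendsto (fun k => levyProkhorovDist (estimatorLaw μ (plugIn hE (riskFunctional ρ) (n k)))
      (estimatorLaw (ν k) (plugIn hE (riskFunctional ρ) (n k)))) atTop (𝓝 0) := by
  refine tendsto_of_subseq_tendsto fun ns hns => ?_
  obtain ⟨φ, hφ, hn⟩ := exists_subseq_const_or_tendsto_atTop (n ∘ ns)
  have hφ' := hns.comp hφ.tendsto_atTop
  obtain ⟨θ, hθ, hgap⟩ := exists_subseq_meanGap_sample (hlim.comp hφ') (hν.comp hφ') hμ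
    (n ∘ ns ∘ φ)
  refine ⟨φ ∘ θ, ?_⟩
  have hmeas (m : ℕ+) : Measurable (plugIn hE (riskFunctional ρ) m) :=
    (continuous_plugIn hP ρ hE m).measurable
  have hdiff := ae_tendsto_plugIn_sample_sub hP ρ hE hμ (n := n ∘ ns ∘ φ ∘ θ)
    (hn.imp (fun ⟨m, hm⟩ => ⟨m, fun k => hm (θ k)⟩) fun h => h.comp hθ.tendsto_atTop) hgap
  simp only [estimatorLaw_eq_map_sample _ (hmeas _)]
  refine tendsto_levyProkhorovDist_map_of_ae (fun j => (hmeas _).comp (measurable_sample μ))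
    (fun j => (hmeas _).comp (measurable_sample _)) ?_
  filter_upwards [hdiff] with u hu
  have h := hu.abs
  rw [abs_zero] at h
  refine h.congr fun k => ?_
  rw [← Real.dist_eq, dist_comm]
  rfl

theorem YoungFunction.LocallyUniformlyIntegrating.isRobustOn {M : Set (ProbabilityMeasure ℝ)}
    (hM : Ψ.LocallyUniformlyIntegrating M) (hP : IsAtomless P) (ρ : RiskMeasure Ψ P)
    (hE : empiricalMeasures ℝ ⊆ laws Ψ P) : IsRobustOn (plugIn hE (riskFunctional ρ)) M := by
  intro κ ε hε
  have hlim : Tendsto (fun p : M × ℕ+ => levyProkhorovDist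
      (estimatorLaw (κ : ProbabilityMeasure ℝ) (plugIn hE (riskFunctional ρ) p.2))
      (estimatorLaw (p.1 : ProbabilityMeasure ℝ) (plugIn hE (riskFunctional ρ) p.2)))
      (𝓝 κ ×ˢ 𝓟 Set.univ) (𝓝 0) := by
    refine tendsto_of_seq_tendsto fun s hs => ?_
    have hfst : Tendsto (fun k => (s k).1) atTop (𝓝 κ) := tendsto_fst.comp hs
    exact tendsto_levyProkhorovDist_estimatorLaw hP ρ hE (hM.hasFiniteMoments κ.2)
      ((continuous_subtype_val.tendsto κ).comp hfst) ((hM κ).comp hfst) _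
  obtain ⟨U, hU, hUo, hκU⟩ := mem_nhds_iff.1
    (eventually_prod_principal_iff.1 (hlim.eventually_le_const hε))
  exact ⟨U, hUo, hκU, fun ν hν n => hU hν n (Set.mem_univ n)⟩

theorem YoungFunction.LocallyUniformlyIntegrating.continuous_riskFunctional
    {M : Set (ProbabilityMeasure ℝ)} (hM : Ψ.LocallyUniformlyIntegrating M) (hP : IsAtomless P)
    (ρ : RiskMeasure Ψ P) (hMlaws : M ⊆ laws Ψ P) :
    Continuous fun ν : M => riskFunctional ρ (Set.inclusion hMlaws ν) :=
  continuous_iff_continuousAt.2 fun κ => tendsto_riskFunctional hP ρ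
    ((continuous_inclusion hMlaws).tendsto κ) (hM κ)

end Robustness

end AggRobust

end

open AggRobust in
theorem mainTheorem5_general {Ω : Type*} [MeasurableSpace Ω] {P : Measure Ω}
    [IsProbabilityMeasure P] (hP : IsAtomless P) {Ψ : YoungFunction} (ρ : RiskMeasure Ψ P)
    {M : Set (ProbabilityMeasure ℝ)} (hM : Ψ.LocallyUniformlyIntegrating M) :
    (∃ hMlaws : M ⊆ laws Ψ P,
      Continuous fun ν : M => riskFunctional ρ (Set.inclusion hMlaws ν)) ∧
    (∃ hE : empiricalMeasures ℝ ⊆ laws Ψ P,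
      (∀ n : ℕ+, Measurable (plugIn hE (riskFunctional ρ) n)) ∧
      IsRobustOn (plugIn hE (riskFunctional ρ)) M) :=
  ⟨⟨hM.subset_laws hP, hM.continuous_riskFunctional hP ρ _⟩, empiricalMeasures_subset_laws hP,
    fun n => (continuous_plugIn hP ρ _ n).measurable, hM.isRobustOn hP ρ _⟩

open AggRobust in
theorem mainTheorem5 {Ω : Type*} [MeasurableSpace Ω] (P : Measure Ω) [IsProbabilityMeasure P]
    (hP : IsAtomless P) (Ψ : YoungFunction) (ρ : RiskMeasure Ψ P)
    (d : ℕ) (A : (Fin d → ℝ) → ℝ) (hA : Measurable A)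
    (hgrowth : ∃ b c : ℝ, 0 < b ∧ 0 < c ∧ ∀ x : Fin d → ℝ, |A x| ≤ b + c * ∑ i, |x i|)
    (μ : Fin d → ProbabilityMeasure ℝ) (hμ : ∀ i, μ i ∈ laws Ψ P) :
    -- the image set lies in the domain of the risk functional, which is weakly continuous on it
    (∃ hM : frechetImage μ A ⊆ laws Ψ P,
      Continuous fun ν : frechetImage μ A => riskFunctional ρ (Set.inclusion hM ν)) ∧
    -- the plug-in estimators are well defined, measurable, and robust on the image set
    (∃ hE : empiricalMeasures ℝ ⊆ laws Ψ P,
      (∀ n : ℕ+, Measurable (plugIn hE (riskFunctional ρ) n)) ∧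
      IsRobustOn (plugIn hE (riskFunctional ρ)) (frechetImage μ A)) := by
  obtain ⟨b, c, -, -, hA_le⟩ := hgrowth
  exact mainTheorem5_general hP ρ <| locallyUniformlyIntegrating_frechetImage hA hA_le
    fun i => hasFiniteMoments_of_mem_laws (hμ i)
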